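/- Consider $n$ agents communicating over an undirected connected weighted graph with weights $a_{ij}=a_{ji}\ge 0$ (where $a_{ij}>0$ exactly when $(i,j)$ is an edge), and the problem $$\text{(P4)}\qquad \min_{\mathbf x=(x_1,\dots,x_n)}\ f(\mathbf x)=\sum_{i=1}^n f_i(x_i)\quad\text{s.t.}\quad \sum_{i=1}^n A_i x_i=b,\qquad x_i\in\mathcal X_i\ \ (i=1,\dots,n),$$ where $x_i\in\mathbb R^{d_i}$, $f_i:\mathbb R^{d_i}\to\mathbb R$, $A_i\in\mathbb R^{p\times d_i}$, $b\in\mathbb R^p$. Assume that, for every $i$, the set $\mathcal X_i\subseteq\mathbb R^{d_i}$ is closed and convex, $f_i$ is convex on $\mathcal X_i$, and $f_i$ is differentiable with locally Lipschitz gradient on an open set containing $\mathcal X_i$. Put $\mathcal X=\prod_{i=1}^n\mathcal X_i$ and assume Slater's condition: some relative interior point of $\mathcal X$ satisfies $\sum_i A_ix_i=b$. Assume also that (P4) has at least one optimal solution. Let $b_1,\dots,b_n\in\mathbb R^p$ satisfy $\sum_i b_i=b$, let $\alpha,\beta>0$, and let $P_{\mathcal X}$ be the Euclidean projection onto $\mathcal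 X$. Proj-IDEA is the following system for $\mathbf w(t)\in\mathbb R^{d_1+\cdots+d_n}$ and $\boldsymbol\lambda(t),\mathbf z(t)\in\mathbb R^{np}$, $t\ge0$: for $i=1,\dots,n$, $$\begin{aligned} \dot w_i&=-\alpha\bigl(w_i-x_i+\nabla f_i(x_i)+A_i^\top\lambda_i\bigr)-A_i^\top(A_ix_i-b_i-z_i),\\ \dot\lambda_i&=A_ix_i-b_i-z_i-\beta\sum_{j=1}^n a_{ij}(\lambda_i-\lambda_j),\\ \dot z_i&=\alpha\beta\sum_{j=1}^n a_{ij}(\lambda_i-\lambda_j),\qquad \mathbf x=P_{\mathcal X}(\mathbf w). \end{aligned}$$ Then for every initial state $(\mathbf w(0),\boldsymbol\lambda(0),\mathbf z(0))$ with $\sum_{i=1}^n z_i(0)=0$, Proj-IDEA has a solution on $[0,\infty)$, and for every such solution the primal output $\mathbf x(t)=P_{\mathcal X}(\mathbf w(t))$ converges, as $t\to\infty$, to an optimal solution of (P4). -/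

import Mathlib

open scoped Gradient Topology

noncomputable section

namespace ProjIDEA

/-- Euclidean space of dimension `k`. -/
abbrev Vec (k : ℕ) : Type := EuclideanSpace ℝ (Fin k)

/-- The space of stacked primal vectors `(x_1, …, x_n)` with `x_i` in dimension `d i`, with its
Euclidean norm. -/
abbrev Primal {n : ℕ} (d : Fin n → ℕ) : Type := PiLp 2 (fun i => Vec (d i))

/-- The space of stacked vectors `(y_1, …, y_n)` with all `y_i` in dimension `p`, with its
Euclidean norm. -/
abbrev Stack (n p : ℕ) : Type := PiLp 2 (fun _ : Fin n => Vec p)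

/-- The metric projection of `y` onto `X`: a point of `X` nearest to `y`. It exists and is unique
when `X` is nonempty, closed and convex. -/
def proj {E : Type*} [NormedAddCommGroup E] (X : Set E) (y : E) : E :=
  Classical.epsilon fun x => x ∈ X ∧ ∀ u ∈ X, ‖y - x‖ ≤ ‖y - u‖

theorem proj_spec {E : Type*} [NormedAddCommGroup E] [InnerProductSpace ℝ E] [CompleteSpace E]
    {X : Set E} (hne : X.Nonempty) (hcl : IsClosed X) (hco : Convex ℝ X) (y : E) :
    proj X y ∈ X ∧ ∀ u ∈ X, ‖y - proj X y‖ ≤ ‖y - u‖ := by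
  have h : ∃ x, x ∈ X ∧ ∀ u ∈ X, ‖y - x‖ ≤ ‖y - u‖ := by
    obtain ⟨v, hv, hmin⟩ := exists_norm_eq_iInf_of_complete_convex hne hcl.isComplete hco y
    refine ⟨v, hv, fun u hu => ?_⟩
    rw [hmin]
    exact ciInf_le ⟨0, by rintro _ ⟨w, rfl⟩; exact norm_nonneg _⟩ (⟨u, hu⟩ : X)
  exact Classical.epsilon_spec h

/-- The data of a constraint-coupled problem for `n` agents: minimize `∑ i, f i (x i)` subject to
`∑ i, A i * x i = b` and `x i ∈ X i` for all `i`. -/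
structure CoupledProblem (n p : ℕ) (d : Fin n → ℕ) where
  /-- local cost functions -/
  f : ∀ i, Vec (d i) → ℝ
  /-- local constraint sets -/
  X : ∀ i, Set (Vec (d i))
  /-- local constraint matrices -/
  A : ∀ i, Matrix (Fin p) (Fin (d i)) ℝ
  /-- right-hand side of the coupling constraint -/
  b : Vec p

namespace CoupledProblem

variable {n p : ℕ} {d : Fin n → ℕ} (P : CoupledProblem n p d)

/-- The global cost. -/
def cost (x : Primal d) : ℝ := ∑ i, P.f i (x i)

/-- The Cartesian product of the local constraint sets. -/
def prodSet : Set (Primal d) := {x | ∀ i, x i ∈ P.X i}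

/-- The coupling constraint `∑ i, A i * x i = b`. -/
def Coupled (x : Primal d) : Prop := ∑ i, (P.A i).toEuclideanLin (x i) = P.b

/-- `x` is feasible and has the least cost among all feasible points. -/
def IsOptimal (x : Primal d) : Prop :=
  (x ∈ P.prodSet ∧ P.Coupled x) ∧ ∀ y ∈ P.prodSet, P.Coupled y → P.cost x ≤ P.cost y

/-- Slater's condition: some relative interior point of the product set satisfies the coupling
constraint. -/
def Slater : Prop := ∃ x ∈ intrinsicInterior ℝ P.prodSet, P.Coupled x

/-- `(w, lam, z)` solves the Proj-IDEA differential equations for all times `t ≥ 0` (with the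
one-sided derivative at `t = 0`), for the step sizes `α`, `β`, the weighted adjacency matrix `a`
and the splitting `bs` of the right-hand side among the agents. The primal output at time `t` is
`proj P.prodSet (w t)`. -/
structure IsTrajectory (a : Matrix (Fin n) (Fin n) ℝ) (bs : Fin n → Vec p) (α β : ℝ)
    (w : ℝ → Primal d) (lam z : ℝ → Stack n p) : Prop where
  deriv_w : ∀ t, 0 ≤ t → ∀ i,
    HasDerivWithinAt (fun s => w s i)
      (-α • (w t i - proj P.prodSet (w t) i + ∇ (P.f i) (proj P.prodSet (w t) i)
          + (P.A i).transpose.toEuclideanLin (lam t i))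
        - (P.A i).transpose.toEuclideanLin
          ((P.A i).toEuclideanLin (proj P.prodSet (w t) i) - bs i - z t i))
      (Set.Ici 0) t
  deriv_lam : ∀ t, 0 ≤ t → ∀ i,
    HasDerivWithinAt (fun s => lam s i)
      ((P.A i).toEuclideanLin (proj P.prodSet (w t) i) - bs i - z t i
        - β • ∑ j, a i j • (lam t i - lam t j))
      (Set.Ici 0) t
  deriv_z : ∀ t, 0 ≤ t → ∀ i,
    HasDerivWithinAt (fun s => z s i)
      ((α * β) • ∑ j, a i j • (lam t i - lam t j))
      (Set.Ici 0) t

end CoupledProblem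

/-- Any two agents are joined by a path of edges, where `(i, j)` is an edge when `a i j > 0`. -/
def GraphConnected {n : ℕ} (a : Matrix (Fin n) (Fin n) ℝ) : Prop :=
  ∀ i j, Relation.ReflTransGen (fun k l => 0 < a k l) i j

end ProjIDEA

end

/-! Stacking the agents turns Proj-IDEA into a flow for minimizing f over X subject to A x - b ∈
range L, where L is the graph Laplacian. For a connected graph, range L is the set of zero-sum
stacks and ker L the set of consensual ones. By Slater's condition an optimal u has a consensual
multiplier μ making (u, μ) a saddle point (`exists_lagrange_multiplier`,
`exists_isSaddle_of_isOptimal`).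

The Lyapunov function `lyap` rests on `projDist`, which is differentiable in w with gradient x - u
although the projection is merely Lipschitz (`hasFDerivAt_projDist`). Along the flow `lyap`
decreases at least at the rate α · (Lagrangian gap) + ‖res‖² / 2 + β² ‖L λ‖² / 2 (`lyapDeriv_le`).
It bounds x, z and λ; then w' = -α w + (bounded) bounds w as well (`exists_bound_of_isFlow`), and
the locally Lipschitz field has global solutions.

Small dissipation along a sequence of times yields a limit point with x' optimal, λ' consensual and
z' = A x' - b, but does not show that λ' is a multiplier. This is obtained without an invariance
principle: for v in X, `projDist` to v decreases at about α times the dual gap f(u) - f(v) - ⟨A v -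
b, λ⟩, while λ hardly moves over a fixed window once `lyap` has nearly settled. Since `projDist`
stays bounded, the gap is eventually at most any δ > 0 (`eventually_dualGap_le`). So (x', λ') is a
saddle point. The Lyapunov function relative to it tends to 0 along a subsequence, hence, being
monotone, along all times, and it dominates ‖x - x'‖² / 2. -/

noncomputable section

namespace ProjIDEA

open Set Filter Metric
open scoped RealInnerProductSpace NNReal

/-! ### Metric projection and a differentiable distance adapted to it -/

section Projection

variable {E : Type*} [NormedAddCommGroup E] [InnerProductSpace ℝ E] [CompleteSpace E]
  {X : Set E}

theorem proj_mem (hne : X.Nonempty) (hcl : IsClosed X) (hco : Convex ℝ X) (y : E) :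
    proj X y ∈ X :=
  (proj_spec hne hcl hco y).1

theorem inner_sub_proj_nonpos (hne : X.Nonempty) (hcl : IsClosed X) (hco : Convex ℝ X) (y : E)
    {u : E} (hu : u ∈ X) : ⟪y - proj X y, u - proj X y⟫ ≤ 0 := by
  obtain ⟨hmem, hmin⟩ := proj_spec hne hcl hco y
  refine (norm_eq_iInf_iff_real_inner_le_zero hco hmem).1 ?_ u hu
  have : Nonempty X := ⟨⟨_, hmem⟩⟩
  refine le_antisymm (le_ciInf fun w => hmin w w.2) ?_
  exact ciInf_le ⟨0, by rintro _ ⟨w, rfl⟩; exact norm_nonneg _⟩ (⟨_, hmem⟩ : X)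

theorem norm_proj_sub_proj_le (hne : X.Nonempty) (hcl : IsClosed X) (hco : Convex ℝ X)
    (y v : E) : ‖proj X y - proj X v‖ ≤ ‖y - v‖ := by
  have h1 := inner_sub_proj_nonpos hne hcl hco y (proj_mem hne hcl hco v)
  have h2 := inner_sub_proj_nonpos hne hcl hco v (proj_mem hne hcl hco y)
  have h3 : ‖proj X y - proj X v‖ ^ 2 ≤ ⟪y - v, proj X y - proj X v⟫ := by
    rw [← real_inner_self_eq_norm_sq]
    simp only [inner_sub_left, inner_sub_right] at *
    linarith
  have h4 := real_inner_le_norm (y - v) (proj X y - proj X v)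
  by_contra! h
  nlinarith [norm_nonneg (y - v), norm_nonneg (proj X y - proj X v)]

theorem lipschitzWith_proj (hne : X.Nonempty) (hcl : IsClosed X) (hco : Convex ℝ X) :
    LipschitzWith 1 (proj X) :=
  LipschitzWith.of_dist_le_mul fun y v => by
    simpa [dist_eq_norm] using norm_proj_sub_proj_le hne hcl hco y v

/-- The Bregman-type distance `(‖w - u‖² - dist(w, X)²) / 2` from `w` to a point `u` of `X`. -/
def projDist (X : Set E) (u w : E) : ℝ := (‖w - u‖ ^ 2 - ‖w - proj X w‖ ^ 2) / 2

/-- The angle at the projection between w and any point of X is obtuse. Thus `projDist` controls the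
output `proj X w`, though not w itself. -/
theorem norm_sq_le_two_mul_projDist (hne : X.Nonempty) (hcl : IsClosed X) (hco : Convex ℝ X)
    {u : E} (hu : u ∈ X) (w : E) : ‖proj X w - u‖ ^ 2 ≤ 2 * projDist X u w := by
  have h := inner_sub_proj_nonpos hne hcl hco w hu
  have h2 : w - u = (w - proj X w) - (u - proj X w) := by abel
  have h3 := norm_sub_sq_real (w - proj X w) (u - proj X w)
  rw [← h2] at h3
  rw [norm_sub_rev (proj X w) u]
  unfold projDist
  linarith

theorem projDist_nonneg (hne : X.Nonempty) (hcl : IsClosed X) (hco : Convex ℝ X)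
    {u : E} (hu : u ∈ X) (w : E) : 0 ≤ projDist X u w := by
  have := norm_sq_le_two_mul_projDist hne hcl hco hu w
  nlinarith [sq_nonneg ‖proj X w - u‖]

omit [InnerProductSpace ℝ E] [CompleteSpace E] in
theorem projDist_proj_self (w : E) : projDist X (proj X w) w = 0 := by
  simp [projDist]

theorem continuous_projDist (hne : X.Nonempty) (hcl : IsClosed X) (hco : Convex ℝ X) (u : E) :
    Continuous (projDist X u) := by
  have := (lipschitzWith_proj hne hcl hco).continuous
  unfold projDist
  fun_prop

/-- Each projection competes in the minimization that defines the other, so to first order the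
distance to X changes as if the nearest point were fixed. The error ⟪q - p, h⟫ is at most ‖h‖²
because the projection is nonexpansive. -/
theorem abs_projDist_add_sub_le (hne : X.Nonempty) (hcl : IsClosed X) (hco : Convex ℝ X)
    (u w h : E) :
    |projDist X u (w + h) - projDist X u w - ⟪proj X w - u, h⟫| ≤ 2 * ‖h‖ ^ 2 := by
  have h1 := (proj_spec hne hcl hco (w + h)).2 _ (proj_mem hne hcl hco w)
  have h2 := (proj_spec hne hcl hco w).2 _ (proj_mem hne hcl hco (w + h))
  have h3 := norm_proj_sub_proj_le hne hcl hco (w + h) w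
  have h4 := real_inner_le_norm (proj X (w + h) - proj X w) h
  set q := proj X (w + h)
  set p := proj X w
  have h1' := pow_le_pow_left₀ (norm_nonneg _) h1 2
  have h2' := pow_le_pow_left₀ (norm_nonneg _) h2 2
  have h5 : ‖w + h - w‖ = ‖h‖ := by simp
  rw [h5] at h3
  have h6 : ⟪q - p, h⟫ ≤ ‖h‖ ^ 2 := by
    nlinarith [norm_nonneg h]
  simp only [projDist, abs_le]
  change -(2 * ‖h‖ ^ 2) ≤ (‖w + h - u‖ ^ 2 - ‖w + h - q‖ ^ 2) / 2 - (‖w - u‖ ^ 2 - ‖w - p‖ ^ 2) / 2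
    - ⟪p - u, h⟫ ∧ (‖w + h - u‖ ^ 2 - ‖w + h - q‖ ^ 2) / 2 - (‖w - u‖ ^ 2 - ‖w - p‖ ^ 2) / 2
    - ⟪p - u, h⟫ ≤ 2 * ‖h‖ ^ 2
  have e1 : ‖w + h - u‖ ^ 2 = ‖w - u‖ ^ 2 + 2 * ⟪w - u, h⟫ + ‖h‖ ^ 2 := by
    rw [add_sub_right_comm, norm_add_sq_real]
  have e2 : ‖w + h - p‖ ^ 2 = ‖w - p‖ ^ 2 + 2 * ⟪w - p, h⟫ + ‖h‖ ^ 2 := by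
    rw [add_sub_right_comm, norm_add_sq_real]
  have e3 : ‖w + h - q‖ ^ 2 = ‖w - q‖ ^ 2 + 2 * ⟪w - q, h⟫ + ‖h‖ ^ 2 := by
    rw [add_sub_right_comm, norm_add_sq_real]
  simp only [inner_sub_left] at *
  have := sq_nonneg ‖h‖
  constructor <;> linarith

theorem hasFDerivAt_projDist (hne : X.Nonempty) (hcl : IsClosed X) (hco : Convex ℝ X)
    (u w : E) : HasFDerivAt (projDist X u) (innerSL ℝ (proj X w - u)) w := by
  rw [hasFDerivAt_iff_isLittleO_nhds_zero]
  refine Asymptotics.IsBigO.trans_isLittleO (g := fun h : E => ‖h‖ ^ 2) ?_ ?_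
  · refine Asymptotics.IsBigO.of_bound 2 (Eventually.of_forall fun h => ?_)
    rw [innerSL_apply_apply, Real.norm_eq_abs, Real.norm_of_nonneg (by positivity)]
    exact abs_projDist_add_sub_le hne hcl hco u w h
  · simpa using Asymptotics.isLittleO_norm_pow_id (E' := E) one_lt_two

end Projection

/-! ### Global solutions of ordinary differential equations -/

section GlobalODE

variable {H : Type*} [NormedAddCommGroup H] [NormedSpace ℝ H] [CompleteSpace H]

/-- A field bounded by B cannot leave the ball of radius B T within time T, so the Picard–Lindelöf
theorem applies on an interval of any length. -/
theorem exists_solution_Icc_of_bounded_lipschitz {v : H → H} {K B : ℝ≥0}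
    (hv : LipschitzWith K v) (hB : ∀ s, ‖v s‖ ≤ B) (x₀ : H) {T : ℝ} (hT : 0 ≤ T) :
    ∃ γ : ℝ → H, γ 0 = x₀ ∧
      ∀ t ∈ Icc 0 T, HasDerivWithinAt γ (v (γ t)) (Icc 0 T) t := by
  have h : IsPicardLindelof (fun _ => v) (⟨0, le_rfl, hT⟩ : Icc (0 : ℝ) T) x₀
      (B * T.toNNReal) 0 B K := by
    refine IsPicardLindelof.of_time_independent (fun s _ => hB s) hv.lipschitzOnWith ?_
    simp [hT]
  exact h.exists_eq_forall_mem_Icc_hasDerivWithinAt₀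

/-- A bounded Lipschitz vector field has a solution on `[0, ∞)` for every initial state. -/
theorem exists_global_solution_of_bounded_lipschitz {v : H → H} {K B : ℝ≥0}
    (hv : LipschitzWith K v) (hB : ∀ s, ‖v s‖ ≤ B) (x₀ : H) :
    ∃ γ : ℝ → H, γ 0 = x₀ ∧ ∀ t, 0 ≤ t → HasDerivWithinAt γ (v (γ t)) (Ici 0) t := by
  choose γ hγ0 hγ using fun N : ℕ =>
    exists_solution_Icc_of_bounded_lipschitz hv hB x₀ (Nat.cast_nonneg (α := ℝ) N)
  have right (N : ℕ) (t : ℝ) (ht : t ∈ Ico (0 : ℝ) N) :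
      HasDerivWithinAt (γ N) (v (γ N t)) (Ici t) t := by
    refine ((hγ N t ⟨ht.1, ht.2.le⟩).mono_of_mem_nhdsWithin ?_)
    exact mem_of_superset (Icc_mem_nhdsGE ht.2) (Icc_subset_Icc_left ht.1)
  have cont (N : ℕ) : ContinuousOn (γ N) (Icc 0 N) := fun t ht =>
    (hγ N t ht).continuousWithinAt
  have uniq (N M : ℕ) (hNM : N ≤ M) : EqOn (γ N) (γ M) (Icc 0 N) := by
    have hc : (N : ℝ) ≤ M := by exact_mod_cast hNM
    refine ODE_solution_unique_of_mem_Icc_right (v := fun _ => v) (s := fun _ => univ) (K := K)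
      (fun _ _ => hv.lipschitzOnWith) (cont N) (right N) (fun _ _ => mem_univ _)
      ((cont M).mono (Icc_subset_Icc_right hc)) (fun t ht => right M t ⟨ht.1, ht.2.trans_le hc⟩)
      (fun _ _ => mem_univ _) ?_
    rw [hγ0, hγ0]
  have key (N : ℕ) (t : ℝ) (ht : t ∈ Icc (0 : ℝ) N) : γ ⌈t⌉₊ t = γ N t :=
    uniq _ _ (Nat.ceil_le.2 ht.2) ⟨ht.1, Nat.le_ceil t⟩
  -- The solutions on [0, N] agree on overlaps by uniqueness, so reading the one with N = ⌈t⌉ at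
  -- time t glues them.
  refine ⟨fun t => γ ⌈t⌉₊ t, by simp [hγ0], fun t ht => ?_⟩
  obtain ⟨N, hN⟩ := exists_nat_gt t
  beta_reduce
  rw [key N t ⟨ht, hN.le⟩]
  have hmem : Icc (0 : ℝ) N ∈ 𝓝[Ici 0] t := by
    rw [← Ici_inter_Iic]
    exact inter_mem_nhdsWithin _ (Iic_mem_nhds hN)
  refine ((hγ N t ⟨ht, hN.le⟩).congr (fun s hs => key N s hs) (key N t ⟨ht, hN.le⟩))
    |>.mono_of_mem_nhdsWithin hmem

/-- A vector field that is Lipschitz on balls, slowed down outside of a ball by a scalar factor,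
has global solutions. -/
theorem exists_global_solution_of_slowed {v : H → H} {x₀ : H} {R B : ℝ}
    {K : ℝ≥0} (hv : LipschitzOnWith K v (closedBall 0 (R + 1)))
    (hB : ∀ s ∈ closedBall (0 : H) (R + 1), ‖v s‖ ≤ B) :
    ∃ (γ : ℝ → H) (χ : ℝ → ℝ), γ 0 = x₀ ∧ (∀ t, 0 ≤ χ t) ∧ (∀ t, ‖γ t‖ ≤ R → χ t = 1) ∧
      ∀ t, 0 ≤ t → HasDerivWithinAt γ (χ t • v (γ t)) (Ici 0) t := by
  -- The cutoff equals 1 on the ball of radius R, vanishes outside radius R + 1, and is 1-Lipschitz.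
  set φ : H → ℝ := fun s => max 0 (min 1 (R + 1 - ‖s‖)) with hφ
  have φ0 (s : H) : 0 ≤ φ s := le_max_left _ _
  have φ1 (s : H) : φ s ≤ 1 := max_le zero_le_one (min_le_left _ _)
  have φout (s : H) (hs : s ∉ closedBall (0 : H) (R + 1)) : φ s = 0 := by
    simp only [mem_closedBall, dist_zero_right, not_le] at hs
    refine max_eq_left ((min_le_right _ _).trans (by linarith))
  have φlip (s u : H) : |φ s - φ u| ≤ ‖s - u‖ := by
    have h := abs_le.1 (abs_norm_sub_norm_le s u)
    simp only [hφ, abs_le]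
    grind
  set B' : ℝ≥0 := B.toNNReal
  have hB' (s : H) (hs : s ∈ closedBall (0 : H) (R + 1)) : ‖v s‖ ≤ B' :=
    (hB s hs).trans (Real.le_coe_toNNReal B)
  -- Only s is required to lie in the ball: the difference is split so that the cutoff increment
  -- multiplies v s, which is bounded there.
  have half (s u : H) (hs : s ∈ closedBall (0 : H) (R + 1)) :
      ‖φ s • v s - φ u • v u‖ ≤ (B' + K) * ‖s - u‖ := by
    have hsplit (y : H) : φ s • v s - φ u • y = (φ s - φ u) • v s + φ u • (v s - y) := by
      simp only [sub_smul, smul_sub]; abel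
    by_cases hu : u ∈ closedBall (0 : H) (R + 1)
    · have h1 : ‖v s - v u‖ ≤ K * ‖s - u‖ := by
        simpa [dist_eq_norm] using hv.dist_le_mul s hs u hu
      rw [hsplit]
      refine (norm_add_le _ _).trans ?_
      rw [norm_smul, norm_smul, Real.norm_eq_abs, Real.norm_eq_abs, abs_of_nonneg (φ0 u)]
      have h2 := mul_le_mul (φlip s u) (hB' s hs) (norm_nonneg _) (norm_nonneg _)
      have h3 := mul_le_mul (φ1 u) h1 (norm_nonneg _) zero_le_one
      linarith
    · have h2 := mul_le_mul (φlip s u) (hB' s hs) (norm_nonneg _) (norm_nonneg _)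
      have h3 : 0 ≤ (K : ℝ) * ‖s - u‖ := by positivity
      rw [φout u hu] at h2 ⊢
      rw [zero_smul, sub_zero, norm_smul, Real.norm_eq_abs]
      rw [sub_zero] at h2
      linarith
  have hlip : LipschitzWith (B' + K) fun s => φ s • v s := by
    refine LipschitzWith.of_dist_le_mul fun s u => ?_
    rw [dist_eq_norm, dist_eq_norm]
    push_cast
    by_cases hs : s ∈ closedBall (0 : H) (R + 1)
    · exact half s u hs
    by_cases hu : u ∈ closedBall (0 : H) (R + 1)
    · rw [norm_sub_rev, norm_sub_rev s]
      exact half u s hu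
    · rw [φout s hs, φout u hu]
      simp only [zero_smul, sub_zero, norm_zero]
      positivity
  have hbd (s : H) : ‖φ s • v s‖ ≤ B' := by
    by_cases hs : s ∈ closedBall (0 : H) (R + 1)
    · rw [norm_smul, Real.norm_of_nonneg (φ0 s)]
      have := mul_le_mul (φ1 s) (hB' s hs) (norm_nonneg _) zero_le_one
      linarith
    · simp [φout s hs]
  obtain ⟨γ, h0, hγ⟩ := exists_global_solution_of_bounded_lipschitz hlip hbd x₀
  refine ⟨γ, fun t => φ (γ t), h0, fun t => φ0 _, fun t ht => ?_, hγ⟩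
  simp only [hφ]
  rw [min_eq_left (by linarith), max_eq_right zero_le_one]

end GlobalODE

/-! ### Scalar differential inequalities -/

section Scalar

/-- If the derivative of a function is nonpositive on `[a, b]` then it is antitone there. -/
theorem antitoneOn_Icc_of_hasDerivWithinAt_Ici {φ φ' : ℝ → ℝ} {a b : ℝ} (ha : 0 ≤ a)
    (hφ : ∀ t, 0 ≤ t → HasDerivWithinAt φ (φ' t) (Ici 0) t) (hφ' : ∀ t ∈ Icc a b, φ' t ≤ 0) :
    AntitoneOn φ (Icc a b) := by
  have hsub : Icc a b ⊆ Ici 0 := fun t ht => ha.trans ht.1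
  refine antitoneOn_of_hasDerivWithinAt_nonpos (convex_Icc a b) (f' := φ') ?_ ?_ ?_
  · exact fun t ht => ((hφ t (hsub ht)).continuousWithinAt).mono hsub
  · exact fun t ht => (hφ t (hsub (interior_subset ht))).mono (interior_subset.trans hsub)
  · exact fun t ht => hφ' t (interior_subset ht)

theorem le_of_hasDerivWithinAt_Ici_nonpos {φ φ' : ℝ → ℝ} {a b : ℝ} (ha : 0 ≤ a) (hab : a ≤ b)
    (hφ : ∀ t, 0 ≤ t → HasDerivWithinAt φ (φ' t) (Ici 0) t) (hφ' : ∀ t ∈ Icc a b, φ' t ≤ 0) :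
    φ b ≤ φ a :=
  antitoneOn_Icc_of_hasDerivWithinAt_Ici ha hφ hφ' ⟨le_rfl, hab⟩ ⟨hab, le_rfl⟩ hab

/-- A function whose derivative is nonpositive wherever its value is at least `M` stays below `M`. -/
theorem le_of_hasDerivWithinAt_Ici_nonpos_above {φ φ' : ℝ → ℝ} {M : ℝ}
    (hφ : ∀ t, 0 ≤ t → HasDerivWithinAt φ (φ' t) (Ici 0) t) (h0 : φ 0 ≤ M)
    (hφ' : ∀ t, 0 ≤ t → M ≤ φ t → φ' t ≤ 0) {t : ℝ} (ht : 0 ≤ t) : φ t ≤ M := by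
  refine le_of_forall_pos_le_add fun ε hε => ?_
  have hδ : 0 < ε / (1 + t) := by positivity
  -- The barrier M + ε (1 + s) / (1 + t) has positive slope, as the strict comparison requires, and
  -- equals M + ε at s = t.
  have key := image_le_of_deriv_right_lt_deriv_boundary' (f := φ) (f' := φ') (a := 0) (b := t)
    (fun s hs => ((hφ s hs.1).continuousWithinAt).mono fun r hr => hr.1)
    (fun s hs => (hφ s hs.1).mono (Ici_subset_Ici.2 hs.1))
    (B := fun s => M + ε / (1 + t) * (1 + s)) (B' := fun _ => ε / (1 + t))
    (by simpa using h0.trans (by linarith)) (by fun_prop)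
    (fun s _ => by
      simpa using ((((hasDerivAt_id s).const_add 1).const_mul (ε / (1 + t))).const_add
        M).hasDerivWithinAt)
    (fun s hs hs' => lt_of_le_of_lt (hφ' s hs.1 (by
      rw [hs']
      have : 0 ≤ ε / (1 + t) * (1 + s) := mul_nonneg hδ.le (by linarith [hs.1])
      linarith)) hδ) ⟨ht, le_rfl⟩
  have : ε / (1 + t) * (1 + t) = ε := by field_simp
  simpa [this] using key

/-- If a function that is bounded below decreases at the rate `q`, then `q` is arbitrarily small
at arbitrarily late times. -/
theorem exists_ge_lt_of_hasDerivWithinAt_le {φ φ' q : ℝ → ℝ} {m : ℝ}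
    (hφ : ∀ t, 0 ≤ t → HasDerivWithinAt φ (φ' t) (Ici 0) t) (hm : ∀ t, 0 ≤ t → m ≤ φ t)
    (hq : ∀ t, 0 ≤ t → φ' t ≤ -q t) {ε : ℝ} (hε : 0 < ε) (N : ℕ) : ∃ t, (N : ℝ) ≤ t ∧ q t < ε := by
  by_contra! h
  have hN : (0 : ℝ) ≤ N := N.cast_nonneg
  have hmN := hm N hN
  set T : ℝ := (φ N - m + 1) / ε
  have hT : 0 ≤ T := by apply div_nonneg _ hε.le; linarith
  have := le_of_hasDerivWithinAt_Ici_nonpos (φ := fun t => φ t + ε * t)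
    (φ' := fun t => φ' t + ε) hN (b := N + T) (by linarith)
    (fun t ht => (hφ t ht).add (by simpa using ((hasDerivAt_id t).const_mul ε).hasDerivWithinAt))
    (fun t ht => by linarith [hq t (hN.trans ht.1), h t ht.1])
  have h2 := hm (N + T) (by linarith)
  have h3 : ε * T = φ N - m + 1 := by simp only [T]; field_simp
  nlinarith

end Scalar

/-! ### Gradient inequality and Lagrange duality -/

section Convex

theorem _root_.ConvexOn.add_inner_gradient_le {E : Type*} [NormedAddCommGroup E]
    [InnerProductSpace ℝ E] [CompleteSpace E] {X : Set E} {f : E → ℝ} (hf : ConvexOn ℝ X f)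
    {x u : E} (hx : x ∈ X) (hu : u ∈ X) (hd : DifferentiableAt ℝ f x) :
    f x + ⟪∇ f x, u - x⟫ ≤ f u := by
  have hline : HasDerivAt (fun t : ℝ => f (AffineMap.lineMap x u t)) ⟪∇ f x, u - x⟫ 0 := by
    have h1 : HasFDerivAt f (InnerProductSpace.toDual ℝ E (∇ f x))
        (AffineMap.lineMap x u (0 : ℝ)) := by
      rw [AffineMap.lineMap_apply_zero]
      exact hd.hasGradientAt.hasFDerivAt
    have h2 : HasDerivAt (AffineMap.lineMap x u : ℝ → E) (u - x) 0 :=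
      AffineMap.hasDerivAt_lineMap
    exact h1.comp_hasDerivAt (0 : ℝ) h2
  have hconv : ConvexOn ℝ (AffineMap.lineMap x u ⁻¹' X : Set ℝ)
      (f ∘ (AffineMap.lineMap x u : ℝ →ᵃ[ℝ] E)) := hf.comp_affineMap _
  have := hconv.le_slope_of_hasDerivAt (x := 0) (y := 1) (by simpa) (by simpa) one_pos hline
  rw [slope_def_field] at this
  simp only [Function.comp_apply, AffineMap.lineMap_apply_one, AffineMap.lineMap_apply_zero,
    sub_zero, div_one] at this
  linarith

/-- The line through x in a direction of the affine span stays in that span, where x is an interior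
point of X. This is the form in which Slater's condition enters the duality proof. -/
theorem exists_pos_add_smul_mem_of_mem_intrinsicInterior {E : Type*} [NormedAddCommGroup E]
    [NormedSpace ℝ E] {X : Set E} {x v : E} (hx : x ∈ intrinsicInterior ℝ X)
    (hv : v ∈ (affineSpan ℝ X).direction) : ∃ ε : ℝ, 0 < ε ∧ x + ε • v ∈ X := by
  obtain ⟨y, hy, rfl⟩ := mem_intrinsicInterior.1 hx
  have hcont : Continuous fun t : ℝ => (⟨(y : E) + t • v, by
      rw [add_comm]
      exact AffineSubspace.vadd_mem_of_mem_direction (Submodule.smul_mem _ t hv) y.2⟩ :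
      affineSpan ℝ X) := by
    fun_prop
  have h0 : ∀ᶠ t : ℝ in 𝓝 0, (y : E) + t • v ∈ X := by
    have := hcont.continuousAt (x := 0)
    have hn : interior (((↑) : affineSpan ℝ X → E) ⁻¹' X) ∈
        𝓝 (⟨(y : E) + (0 : ℝ) • v, by simp⟩ : affineSpan ℝ X) := by
      refine isOpen_interior.mem_nhds ?_
      simpa using hy
    filter_upwards [this hn] with t ht
    exact interior_subset (s := ((↑) : affineSpan ℝ X → E) ⁻¹' X) ht
  obtain ⟨ε, hε, hpos⟩ := ((h0.filter_mono nhdsWithin_le_nhds).and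
    (self_mem_nhdsWithin (s := Ioi (0 : ℝ)))).exists
  exact ⟨ε, hpos, hε⟩

/-- Strong Lagrange duality for a convex function on a convex set under linear equality
constraints that are satisfied by a relative interior point. -/
theorem exists_lagrange_multiplier {E G : Type*} [NormedAddCommGroup E] [NormedSpace ℝ E]
    [AddCommGroup G] [Module ℝ G] {X : Set E} {f : E → ℝ} (hf : ConvexOn ℝ X f)
    (B : E →ₗ[ℝ] G) {c : G} {m : ℝ} (hm : ∀ u ∈ X, B u = c → m ≤ f u)
    (hslater : ∃ x ∈ intrinsicInterior ℝ X, B x = c) :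
    ∃ μ : G →ₗ[ℝ] ℝ, ∀ u ∈ X, m ≤ f u + μ (B u - c) := by
  obtain ⟨x, hx, hxc⟩ := hslater
  have hxX : x ∈ X := intrinsicInterior_subset hx
  -- Constraint values are restricted to the span of those that X can produce; a relative interior
  -- point then reaches every direction of W.
  set W : Submodule ℝ G := (affineSpan ℝ X).direction.map B with hW
  have hBW (u : E) (hu : u ∈ X) : B u - c ∈ W := by
    rw [← hxc, ← map_sub]
    exact Submodule.mem_map_of_mem
      (AffineSubspace.vsub_mem_direction (mem_affineSpan ℝ hu) (mem_affineSpan ℝ hxX))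
  let S : PointedCone ℝ (W × ℝ) :=
    { carrier := {q | ∃ r : ℝ, 0 ≤ r ∧ ∃ u ∈ X, (q.1 : G) = r • (B u - c) ∧ r * (f u - m) ≤ q.2}
      zero_mem' := ⟨0, le_rfl, x, hxX, by simp, by simp⟩
      add_mem' := by
        rintro p q ⟨r, hr, u, hu, h1, h2⟩ ⟨s, hs, v, hv, h3, h4⟩
        rcases (add_nonneg hr hs).eq_or_lt with h | h
        · have hr0 : r = 0 := by linarith
          have hs0 : s = 0 := by linarith
          subst hr0 hs0
          refine ⟨0, le_rfl, x, hxX, by simp [h1, h3], ?_⟩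
          simp only [zero_mul, Prod.snd_add] at *
          linarith
        · have ha : 0 ≤ r / (r + s) := by positivity
          have hb : 0 ≤ s / (r + s) := by positivity
          have hab : r / (r + s) + s / (r + s) = 1 := by field_simp
          refine ⟨r + s, h.le, _, hf.1 hu hv ha hb hab, ?_, ?_⟩
          · simp only [Prod.fst_add, Submodule.coe_add, h1, h3, map_add, map_smul, smul_sub,
              smul_add, smul_smul, add_smul]
            rw [mul_div_cancel₀ _ h.ne', mul_div_cancel₀ _ h.ne']
            abel
          · have := hf.2 hu hv ha hb hab
            have h5 := mul_le_mul_of_nonneg_left this h.le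
            simp only [smul_eq_mul] at h5
            have h6 : (r + s) * (r / (r + s) * f u + s / (r + s) * f v) = r * f u + s * f v := by
              field_simp
            simp only [Prod.snd_add]
            linarith
      smul_mem' := by
        rintro ⟨a, ha⟩ q ⟨r, hr, u, hu, h1, h2⟩
        refine ⟨a * r, mul_nonneg ha hr, u, hu, ?_, ?_⟩
        · change ((a • q.1 : W) : G) = _
          rw [Submodule.coe_smul, h1, smul_smul]
        · change _ ≤ a * q.2
          rw [mul_assoc]
          exact mul_le_mul_of_nonneg_left h2 ha }
  -- The functional (0, t) ↦ t is nonnegative on the cone because m bounds f on the feasible points.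
  -- A positive extension to W × ℝ has the form (y, t) ↦ μ y + t, which gives the multiplier.
  let F : (W × ℝ) →ₗ.[ℝ] ℝ :=
    { domain := (⊥ : Submodule ℝ W).prod ⊤
      toFun := (LinearMap.snd ℝ W ℝ).comp (Submodule.subtype _) }
  have nonneg (q : F.domain) (hq : (q : W × ℝ) ∈ S) : 0 ≤ F q := by
    revert q
    rintro ⟨⟨w, t⟩, hw⟩ ⟨r, hr, u, hu, h1, h2⟩
    have hw0 : w = 0 := by simpa [F] using hw
    subst hw0
    change 0 ≤ t
    change r * (f u - m) ≤ t at h2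
    rcases hr.eq_or_lt with h | h
    · rw [← h] at h2
      linarith
    · have hc : B u = c := by
        have : r • (B u - c) = 0 := h1.symm
        exact sub_eq_zero.1 ((smul_eq_zero.1 this).resolve_left h.ne')
      have := mul_nonneg hr (sub_nonneg.2 (hm u hu hc))
      linarith
  have dense (q : W × ℝ) : ∃ y : F.domain, (y : W × ℝ) + q ∈ S := by
    revert q
    rintro ⟨⟨w, hw⟩, t⟩
    obtain ⟨v, hv, rfl⟩ := hw
    obtain ⟨ε, hε, hmem⟩ := exists_pos_add_smul_mem_of_mem_intrinsicInterior hx hv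
    -- Moving from the Slater point by ε v changes the constraint value by ε B v, so the cone factor
    -- ε⁻¹ produces exactly B v.
    refine ⟨⟨(0, ε⁻¹ * (f (x + ε • v) - m) - t), by simp [F]⟩, ε⁻¹, by positivity, _, hmem, ?_, ?_⟩
    · simp [hxc, smul_smul, hε.ne']
    · simp
  obtain ⟨g, hgF, hgS⟩ := riesz_extension S F nonneg dense
  have hg (w : W) (t : ℝ) : g (w, t) = g (w, 0) + t := by
    have h1 : g (0, t) = t := hgF ⟨(0, t), by simp [F]⟩
    rw [← h1, ← map_add, h1]
    simp
  obtain ⟨μ, hμ⟩ := LinearMap.exists_extend (g.comp (LinearMap.inl ℝ W ℝ))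
  refine ⟨μ, fun u hu => ?_⟩
  have h1 := hgS (⟨B u - c, hBW u hu⟩, f u - m) ⟨1, zero_le_one, u, hu, by simp, by simp⟩
  have h2 : μ (B u - c) = g (⟨B u - c, hBW u hu⟩, 0) :=
    LinearMap.congr_fun hμ ⟨B u - c, hBW u hu⟩
  rw [hg, ← h2] at h1
  linarith

end Convex

/-! ### Symmetric positive operators and inverses on the range -/

section PositiveOperators

variable {F : Type*} [NormedAddCommGroup F] [InnerProductSpace ℝ F]

/-- A linear map has a linear right inverse on its range. -/
theorem exists_rightInverse_on_range [FiniteDimensional ℝ F] (L : F →L[ℝ] F) :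
    ∃ M : F →L[ℝ] F, ∀ z ∈ range L, L (M z) = z := by
  obtain ⟨g, hg⟩ := (L : F →ₗ[ℝ] F).rangeRestrict.exists_rightInverse_of_surjective
    (LinearMap.range_rangeRestrict _)
  obtain ⟨M, hM⟩ := LinearMap.exists_extend g
  refine ⟨LinearMap.toContinuousLinearMap M, ?_⟩
  rintro _ ⟨v, rfl⟩
  have h1 := LinearMap.congr_fun hM ⟨L v, LinearMap.mem_range_self _ v⟩
  have h2 : L (g ⟨L v, LinearMap.mem_range_self _ v⟩) = L v :=
    congrArg Subtype.val (LinearMap.congr_fun hg ⟨L v, LinearMap.mem_range_self _ v⟩)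
  rw [← h1] at h2
  exact h2

/-- Positivity is tested on k x - L x with k = ‖L‖ + 1, where the added 1 keeps k positive when L =
0. Applied to M z, the bound makes ⟪z, M z⟫ coercive on range L. -/
theorem norm_sq_apply_le_of_symm_of_nonneg {L : F →L[ℝ] F} (hsymm : ∀ x y, ⟪L x, y⟫ = ⟪x, L y⟫)
    (hpos : ∀ x, 0 ≤ ⟪x, L x⟫) (x : F) : ‖L x‖ ^ 2 ≤ (‖L‖ + 1) * ⟪x, L x⟫ := by
  have hk : 0 < ‖L‖ + 1 := by positivity
  have h := hpos ((‖L‖ + 1) • x - L x)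
  have h1 : ⟪L x, L (L x)⟫ ≤ (‖L‖ + 1) * ‖L x‖ ^ 2 := by
    refine (real_inner_le_norm _ _).trans ?_
    nlinarith [L.le_opNorm (L x), norm_nonneg (L x)]
  simp only [map_sub, map_smul, inner_sub_left, inner_sub_right, inner_smul_left,
    inner_smul_right, RCLike.conj_to_real, ← hsymm x (L x), real_inner_self_eq_norm_sq] at h
  have h2 : 0 ≤ (‖L‖ + 1) * ((‖L‖ + 1) * ⟪x, L x⟫ - ‖L x‖ ^ 2) := by linarith
  linarith [(mul_nonneg_iff_of_pos_left hk).1 h2]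

end PositiveOperators

/-- The data of a projected primal-dual flow: a constraint set `X`, a cost `f` with gradient `g`, a
constraint operator `A` with adjoint `At`, a right-hand side `b`, a consensus operator `L` and two
step sizes. -/
structure SaddleSystem (E F : Type*) [NormedAddCommGroup E] [InnerProductSpace ℝ E]
    [NormedAddCommGroup F] [InnerProductSpace ℝ F] where
  X : Set E
  f : E → ℝ
  g : E → E
  A : E →L[ℝ] F
  At : F →L[ℝ] E
  L : F →L[ℝ] F
  b : F
  α : ℝ
  β : ℝ

/-! ### The saddle system, its Lyapunov function and the dissipation inequality -/

namespace SaddleSystem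

variable {E F : Type*} [NormedAddCommGroup E] [InnerProductSpace ℝ E]
  [NormedAddCommGroup F] [InnerProductSpace ℝ F]

/-- The standing assumptions on a saddle system. -/
structure Regular (S : SaddleSystem E F) : Prop where
  nonempty : S.X.Nonempty
  closed : IsClosed S.X
  convex : Convex ℝ S.X
  add_inner_le : ∀ x ∈ S.X, ∀ u ∈ S.X, S.f x + ⟪S.g x, u - x⟫ ≤ S.f u
  continuousOn_f : ContinuousOn S.f S.X
  lipschitz_g : ∀ R, ∃ K, LipschitzOnWith K S.g (S.X ∩ closedBall 0 R)
  adjoint : ∀ x y, ⟪S.A x, y⟫ = ⟪x, S.At y⟫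
  symm : ∀ x y, ⟪S.L x, y⟫ = ⟪x, S.L y⟫
  pos : ∀ x, 0 ≤ ⟪x, S.L x⟫
  α_pos : 0 < S.α
  β_pos : 0 < S.β

variable (S : SaddleSystem E F)

/-- The residual of the decoupled constraint. -/
def res (w : E) (z : F) : F := S.A (proj S.X w) - S.b - z

/-- The velocity of the primal variable. -/
def velW (w : E) (l z : F) : E :=
  -S.α • (w - proj S.X w + S.g (proj S.X w) + S.At l) - S.At (S.res w z)

/-- The velocity of the multiplier. -/
def velL (w : E) (l z : F) : F := S.res w z - S.β • S.L l

/-- The velocity of the auxiliary variable. -/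
def velZ (l : F) : F := (S.α * S.β) • S.L l

/-- `(w, l, z)` follows the primal-dual flow at the time-dependent speed `χ`. -/
structure IsFlow (χ : ℝ → ℝ) (w : ℝ → E) (l z : ℝ → F) : Prop where
  deriv_w : ∀ t, 0 ≤ t → HasDerivWithinAt w (χ t • S.velW (w t) (l t) (z t)) (Ici 0) t
  deriv_l : ∀ t, 0 ≤ t → HasDerivWithinAt l (χ t • S.velL (w t) (l t) (z t)) (Ici 0) t
  deriv_z : ∀ t, 0 ≤ t → HasDerivWithinAt z (χ t • S.velZ (l t)) (Ici 0) t

/-- `(u, μ)` is a saddle point of the Lagrangian of the problem of minimizing `f` over `X`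
subject to `A u - b ∈ range L`. -/
structure IsSaddle (u : E) (μ : F) : Prop where
  mem : u ∈ S.X
  feasible : S.A u - S.b ∈ range S.L
  ker : S.L μ = 0
  le : ∀ x ∈ S.X, S.f u ≤ S.f x + ⟪μ, S.A x - S.b⟫

/-- The Lyapunov function of the flow relative to a saddle point `(u, μ)`; here `M` is a right
inverse of `L` on its range. -/
def lyap (M : F →L[ℝ] F) (u : E) (μ : F) (w : E) (l z : F) : ℝ :=
  projDist S.X u w + 1 / (2 * S.α) * ‖S.α • (l - μ) + (z - (S.A u - S.b))‖ ^ 2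
    + 1 / (2 * S.β) * ⟪z - (S.A u - S.b), M (z - (S.A u - S.b))⟫ + S.β / 2 * ⟪l, S.L l⟫

/-- The derivative of the Lyapunov function along the flow. -/
def lyapDeriv (M : F →L[ℝ] F) (u : E) (μ : F) (w : E) (l z : F) : ℝ :=
  ⟪proj S.X w - u, S.velW w l z⟫
    + 1 / S.α * ⟪S.α • (l - μ) + (z - (S.A u - S.b)), S.α • S.velL w l z + S.velZ l⟫
    + 1 / (2 * S.β) * (⟪z - (S.A u - S.b), M (S.velZ l)⟫ + ⟪S.velZ l, M (z - (S.A u - S.b))⟫)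
    + S.β / 2 * (⟪l, S.L (S.velL w l z)⟫ + ⟪S.velL w l z, S.L l⟫)

variable {S}

namespace Regular

variable (hS : S.Regular)
include hS

theorem inner_eq_zero_of_ker {μ z : F} (hμ : S.L μ = 0) (hz : z ∈ range S.L) : ⟪μ, z⟫ = 0 := by
  obtain ⟨v, rfl⟩ := hz
  rw [← hS.symm, hμ, inner_zero_left]

theorem inner_velW (u w : E) (l z : F) : ⟪proj S.X w - u, S.velW w l z⟫ =
    -S.α * (⟪proj S.X w - u, w - proj S.X w⟫ + ⟪proj S.X w - u, S.g (proj S.X w)⟫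
      + ⟪S.A (proj S.X w - u), l⟫) - ⟪S.A (proj S.X w - u), S.res w z⟫ := by
  rw [velW, inner_sub_right, inner_smul_right, inner_add_right, inner_add_right, hS.adjoint,
    hS.adjoint]

section RightInverse

variable {M : F →L[ℝ] F} (hM : ∀ z ∈ range S.L, S.L (M z) = z)
include hM

theorem inner_rightInverse (z : F) (hz : z ∈ range S.L) (l : F) : ⟪S.L l, M z⟫ = ⟪z, l⟫ := by
  rw [hS.symm, hM z hz, real_inner_comm]

/-- M need not be symmetric, but paired with vectors of range L it acts as a symmetric inverse.
Hence both terms in the derivative of ⟪ζ, M ζ⟫ can be evaluated. -/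
theorem inner_rightInverse_apply (z : F) (hz : z ∈ range S.L) (l : F) :
    ⟪z, M (S.L l)⟫ = ⟪z, l⟫ := by
  conv_lhs => rw [← hM z hz]
  rw [hS.symm, hM _ ⟨l, rfl⟩, real_inner_comm, hS.inner_rightInverse hM z hz]

theorem norm_sq_le_inner_rightInverse (z : F) (hz : z ∈ range S.L) :
    ‖z‖ ^ 2 ≤ (‖S.L‖ + 1) * ⟪z, M z⟫ := by
  have := norm_sq_apply_le_of_symm_of_nonneg hS.symm hS.pos (M z)
  rwa [hM z hz, real_inner_comm] at this

theorem inner_rightInverse_nonneg (z : F) (hz : z ∈ range S.L) : 0 ≤ ⟪z, M z⟫ := by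
  have := hS.pos (M z)
  rwa [hM z hz, real_inner_comm] at this

end RightInverse

variable [CompleteSpace E]

/-- The primal part of the flow decreases `projDist` at the rate of the Lagrangian gap. -/
theorem inner_velW_le {u : E} (hu : u ∈ S.X) (w : E) (l z : F) :
    ⟪proj S.X w - u, S.velW w l z⟫ ≤
      -S.α * (S.f (proj S.X w) - S.f u + ⟪S.A (proj S.X w - u), l⟫)
        - ⟪S.A (proj S.X w - u), S.res w z⟫ := by
  rw [hS.inner_velW]
  have hx := proj_mem hS.nonempty hS.closed hS.convex w
  have h1 := inner_sub_proj_nonpos hS.nonempty hS.closed hS.convex w hu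
  have h2 := hS.add_inner_le _ hx u hu
  have h3 : ⟪proj S.X w - u, w - proj S.X w⟫ = -⟪w - proj S.X w, u - proj S.X w⟫ := by
    rw [real_inner_comm, ← inner_neg_right, neg_sub]
  have h4 : ⟪proj S.X w - u, S.g (proj S.X w)⟫ = -⟪S.g (proj S.X w), u - proj S.X w⟫ := by
    rw [real_inner_comm, ← inner_neg_right, neg_sub]
  have := mul_nonneg hS.α_pos.le (sub_nonneg.2 h2)
  have := mul_nonneg hS.α_pos.le (neg_nonneg.2 h1)
  rw [h3, h4]
  linarith

/-- The cross terms in l and ζ from the primal part cancel against the mixed square and the M-term.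
What remains is the gap, -‖r‖² - β² ‖L l‖² and the product β ⟪r, L l⟫, which costs half of both
squares. -/
theorem lyapDeriv_le {M : F →L[ℝ] F} (hM : ∀ z ∈ range S.L, S.L (M z) = z) {u : E} {μ : F} (hsad : S.IsSaddle u μ) (w : E) (l z : F)
    (hz : z ∈ range S.L) :
    S.lyapDeriv M u μ w l z ≤
      -(S.α * (S.f (proj S.X w) - S.f u + ⟪μ, S.A (proj S.X w) - S.b⟫)
        + 1 / 2 * ‖S.res w z‖ ^ 2 + S.β ^ 2 / 2 * ‖S.L l‖ ^ 2) := by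
  have hα := hS.α_pos
  have hβ := hS.β_pos
  have h1 := hS.inner_velW_le hsad.mem w l z
  unfold lyapDeriv
  set ζ := z - (S.A u - S.b) with hζ
  have hζr : ζ ∈ range S.L := by
    obtain ⟨p, hp⟩ := hz
    obtain ⟨q, hq⟩ := hsad.feasible
    exact ⟨p - q, by rw [map_sub, hp, hq]⟩
  set r := S.res w z with hr
  have hA : S.A (proj S.X w - u) = r + ζ := by
    rw [hr, hζ, res, map_sub]; abel
  have hAx : S.A (proj S.X w) - S.b = r + z := by rw [hr, res]; abel
  have hμζ := hS.inner_eq_zero_of_ker hsad.ker hζr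
  have hμz := hS.inner_eq_zero_of_ker hsad.ker hz
  -- The Laplacian terms cancel in α λ' + z'; this dictates the mixed square in `lyap`.
  have e2 : S.α • S.velL w l z + S.velZ l = S.α • r := by
    rw [velL, velZ, ← hr]; module
  have e3 : ⟪ζ, M (S.velZ l)⟫ = S.α * S.β * ⟪ζ, l⟫ := by
    rw [velZ, map_smul, inner_smul_right, hS.inner_rightInverse_apply hM ζ hζr]
  have e4 : ⟪S.velZ l, M ζ⟫ = S.α * S.β * ⟪ζ, l⟫ := by
    rw [velZ, inner_smul_left, hS.inner_rightInverse hM ζ hζr]; rfl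
  have e5 : ⟪S.velL w l z, S.L l⟫ = ⟪r, S.L l⟫ - S.β * ‖S.L l‖ ^ 2 := by
    rw [velL, inner_sub_left, inner_smul_left, real_inner_self_eq_norm_sq]; rfl
  have e6 : ⟪l, S.L (S.velL w l z)⟫ = ⟪r, S.L l⟫ - S.β * ‖S.L l‖ ^ 2 := by
    rw [← hS.symm, real_inner_comm, e5]
  rw [hA] at h1
  rw [e2, e3, e4, e5, e6, hAx]
  have e7 : 1 / S.α * ⟪S.α • (l - μ) + ζ, S.α • r⟫ = S.α * (⟪l, r⟫ - ⟪μ, r⟫) + ⟪ζ, r⟫ := by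
    simp only [inner_add_left, inner_smul_left, inner_smul_right, inner_sub_left,
      RCLike.conj_to_real]
    field_simp
  have e8 : 1 / (2 * S.β) * (S.α * S.β * ⟪ζ, l⟫ + S.α * S.β * ⟪ζ, l⟫) = S.α * ⟪ζ, l⟫ := by
    field_simp; ring
  have e9 : 2 * S.β * ⟪r, S.L l⟫ ≤ ‖r‖ ^ 2 + S.β ^ 2 * ‖S.L l‖ ^ 2 := by
    have := real_inner_le_norm r (S.L l)
    nlinarith [sq_nonneg (‖r‖ - S.β * ‖S.L l‖)]
  rw [e7, e8, inner_add_right, hμz]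
  simp only [inner_add_left, real_inner_self_eq_norm_sq] at h1
  rw [real_inner_comm r l]
  linarith

end Regular

end SaddleSystem

/-! ### Coercivity of the Lyapunov function and a priori bounds -/

namespace SaddleSystem

variable {E F : Type*} [NormedAddCommGroup E] [InnerProductSpace ℝ E]
  [NormedAddCommGroup F] [InnerProductSpace ℝ F] {S : SaddleSystem E F}

namespace Regular

variable (hS : S.Regular)
include hS

omit hS in
theorem range_sub {z z' : F} (hz : z ∈ range S.L) (hz' : z' ∈ range S.L) :
    z - z' ∈ range S.L := by
  obtain ⟨p, rfl⟩ := hz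
  obtain ⟨q, rfl⟩ := hz'
  exact ⟨p - q, map_sub _ _ _⟩

theorem lyap_terms_nonneg {M : F →L[ℝ] F} (hM : ∀ z ∈ range S.L, S.L (M z) = z)
    (p ζ l : F) (hζ : ζ ∈ range S.L) :
    0 ≤ 1 / (2 * S.α) * ‖p‖ ^ 2 ∧ 0 ≤ 1 / (2 * S.β) * ⟪ζ, M ζ⟫ ∧ 0 ≤ S.β / 2 * ⟪l, S.L l⟫ := by
  have := hS.α_pos
  have := hS.β_pos
  have := hS.inner_rightInverse_nonneg hM ζ hζ
  have := hS.pos l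
  refine ⟨by positivity, by positivity, by positivity⟩

variable [CompleteSpace E]

section Lyap

variable {M : F →L[ℝ] F} (hM : ∀ z ∈ range S.L, S.L (M z) = z)
  {u : E} {μ : F} (hsad : S.IsSaddle u μ)
include hM hsad

omit [CompleteSpace E] in
theorem projDist_le_lyap (w : E) (l : F) {z : F} (hz : z ∈ range S.L) :
    projDist S.X u w ≤ S.lyap M u μ w l z := by
  obtain ⟨h1, h2, h3⟩ := hS.lyap_terms_nonneg hM
    (S.α • (l - μ) + (z - (S.A u - S.b))) (z - (S.A u - S.b)) l (range_sub hz hsad.feasible)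
  unfold lyap
  linarith

theorem lyap_nonneg (w : E) (l : F) {z : F} (hz : z ∈ range S.L) : 0 ≤ S.lyap M u μ w l z :=
  (projDist_nonneg hS.nonempty hS.closed hS.convex hsad.mem w).trans
    (hS.projDist_le_lyap hM hsad w l hz)

theorem norm_sq_proj_sub_le_lyap (w : E) (l : F) {z : F} (hz : z ∈ range S.L) :
    ‖proj S.X w - u‖ ^ 2 ≤ 2 * S.lyap M u μ w l z := by
  have h1 := norm_sq_le_two_mul_projDist hS.nonempty hS.closed hS.convex hsad.mem w
  have h2 := hS.projDist_le_lyap hM hsad w l hz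
  linarith

theorem norm_sq_mixed_le_lyap (w : E) (l : F) {z : F} (hz : z ∈ range S.L) :
    ‖S.α • (l - μ) + (z - (S.A u - S.b))‖ ^ 2 ≤ 2 * S.α * S.lyap M u μ w l z := by
  have hα := hS.α_pos
  obtain ⟨h1, h2, h3⟩ := hS.lyap_terms_nonneg hM
    (S.α • (l - μ) + (z - (S.A u - S.b))) (z - (S.A u - S.b)) l (range_sub hz hsad.feasible)
  have h4 := projDist_nonneg hS.nonempty hS.closed hS.convex hsad.mem w
  have h5 : 1 / (2 * S.α) * ‖S.α • (l - μ) + (z - (S.A u - S.b))‖ ^ 2 ≤ S.lyap M u μ w l z := by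
    unfold lyap
    linarith
  have h6 := mul_le_mul_of_nonneg_left h5 (by positivity : 0 ≤ 2 * S.α)
  rwa [← mul_assoc, mul_one_div_cancel (by positivity), one_mul] at h6

theorem norm_sq_aux_le_lyap (w : E) (l : F) {z : F} (hz : z ∈ range S.L) :
    ‖z - (S.A u - S.b)‖ ^ 2 ≤ (‖S.L‖ + 1) * (2 * S.β * S.lyap M u μ w l z) := by
  have hβ := hS.β_pos
  have hζ := range_sub hz hsad.feasible
  obtain ⟨h1, h2, h3⟩ := hS.lyap_terms_nonneg hM
    (S.α • (l - μ) + (z - (S.A u - S.b))) (z - (S.A u - S.b)) l hζ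
  have h4 := projDist_nonneg hS.nonempty hS.closed hS.convex hsad.mem w
  have h5 : 1 / (2 * S.β) * ⟪z - (S.A u - S.b), M (z - (S.A u - S.b))⟫
      ≤ S.lyap M u μ w l z := by
    unfold lyap
    linarith
  have h6 := mul_le_mul_of_nonneg_left h5 (by positivity : 0 ≤ 2 * S.β)
  rw [← mul_assoc, mul_one_div_cancel (by positivity), one_mul] at h6
  exact (hS.norm_sq_le_inner_rightInverse hM _ hζ).trans
    (mul_le_mul_of_nonneg_left h6 (by positivity))

omit hM in
theorem gap_nonneg (w : E) :
    0 ≤ S.f (proj S.X w) - S.f u + ⟪μ, S.A (proj S.X w) - S.b⟫ := by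
  linarith [hsad.le _ (proj_mem hS.nonempty hS.closed hS.convex w)]

theorem lyapDeriv_nonpos (w : E) (l : F) {z : F} (hz : z ∈ range S.L) :
    S.lyapDeriv M u μ w l z ≤ 0 := by
  have := hS.lyapDeriv_le hM hsad w l z hz
  have h1 := mul_nonneg hS.α_pos.le (hS.gap_nonneg hsad w)
  have : 0 ≤ 1 / 2 * ‖S.res w z‖ ^ 2 := by positivity
  have : 0 ≤ S.β ^ 2 / 2 * ‖S.L l‖ ^ 2 := by positivity
  linarith

end Lyap

theorem hasDerivWithinAt_projDist {χ : ℝ → ℝ} {w : ℝ → E} {l z : ℝ → F}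
    (hfl : S.IsFlow χ w l z) (u : E) {t : ℝ} (ht : 0 ≤ t) :
    HasDerivWithinAt (fun t => projDist S.X u (w t))
      (χ t * ⟪proj S.X (w t) - u, S.velW (w t) (l t) (z t)⟫) (Ici 0) t := by
  have := (hasFDerivAt_projDist hS.nonempty hS.closed hS.convex u (w t)).comp_hasDerivWithinAt t
    (hfl.deriv_w t ht)
  rwa [innerSL_apply_apply, inner_smul_right] at this

theorem hasDerivWithinAt_lyap {χ : ℝ → ℝ} {w : ℝ → E} {l z : ℝ → F}
    (hfl : S.IsFlow χ w l z) (M : F →L[ℝ] F) (u : E) (μ : F) {t : ℝ} (ht : 0 ≤ t) :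
    HasDerivWithinAt (fun t => S.lyap M u μ (w t) (l t) (z t))
      (χ t * S.lyapDeriv M u μ (w t) (l t) (z t)) (Ici 0) t := by
  have hl := hfl.deriv_l t ht
  have hz := hfl.deriv_z t ht
  have hζ := hz.sub_const (S.A u - S.b)
  have hp := ((hl.sub_const μ).const_smul S.α).add hζ
  have hMζ := M.hasFDerivAt.comp_hasDerivWithinAt t hζ
  have hLl := S.L.hasFDerivAt.comp_hasDerivWithinAt t hl
  have h := (((hS.hasDerivWithinAt_projDist hfl u ht).add
    (hp.norm_sq.const_mul (1 / (2 * S.α)))).add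
    ((hζ.inner ℝ hMζ).const_mul (1 / (2 * S.β)))).add
    ((hl.inner ℝ hLl).const_mul (S.β / 2))
  refine h.congr_deriv ?_
  have hα := hS.α_pos.ne'
  have e1 : S.α • χ t • S.velL (w t) (l t) (z t) + χ t • S.velZ (l t)
      = χ t • (S.α • S.velL (w t) (l t) (z t) + S.velZ (l t)) := by module
  simp only [lyapDeriv, Function.comp_apply, Pi.add_apply, Pi.smul_apply, e1, map_smul, inner_smul_left, inner_smul_right, RCLike.conj_to_real]
  field_simp

theorem antitoneOn_lyap {M : F →L[ℝ] F} (hM : ∀ z ∈ range S.L, S.L (M z) = z)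
    {u : E} {μ : F} (hsad : S.IsSaddle u μ) {χ : ℝ → ℝ} (hχ : ∀ t, 0 ≤ χ t) {w : ℝ → E}
    {l z : ℝ → F} (hfl : S.IsFlow χ w l z) (hz : ∀ t, 0 ≤ t → z t ∈ range S.L) {a b : ℝ}
    (ha : 0 ≤ a) (hab : a ≤ b) :
    S.lyap M u μ (w b) (l b) (z b) ≤ S.lyap M u μ (w a) (l a) (z a) :=
  le_of_hasDerivWithinAt_Ici_nonpos (φ := fun t => S.lyap M u μ (w t) (l t) (z t)) ha hab
    (fun _ ht => hS.hasDerivWithinAt_lyap hfl M u μ ht)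
    (fun t ht => mul_nonpos_of_nonneg_of_nonpos (hχ t)
      (hS.lyapDeriv_nonpos hM hsad _ _ (hz t (ha.trans ht.1))))

omit hS [CompleteSpace E] in
-- Since z' lies in range L, the pairing of z with any vector orthogonal to range L is constant in
-- time; in finite dimension range L is its own double orthogonal complement.
theorem mem_range_of_isFlow [FiniteDimensional ℝ F] {χ : ℝ → ℝ} {w : ℝ → E} {l z : ℝ → F}
    (hfl : S.IsFlow χ w l z) (h0 : z 0 ∈ range S.L) {t : ℝ} (ht : 0 ≤ t) : z t ∈ range S.L := by
  set W : Submodule ℝ F := (S.L : F →ₗ[ℝ] F).range with hW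
  change z t ∈ W
  rw [← W.orthogonal_orthogonal]
  intro v hv
  have hv' (x : F) : ⟪v, S.L x⟫ = 0 := by
    rw [real_inner_comm]
    exact hv _ (LinearMap.mem_range_self (S.L : F →ₗ[ℝ] F) x)
  have hd (s : ℝ) (hs : 0 ≤ s) : HasDerivWithinAt (fun t => ⟪v, z t⟫) 0 (Ici 0) s := by
    have := (innerSL ℝ v).hasFDerivAt.comp_hasDerivWithinAt s (hfl.deriv_z s hs)
    refine this.congr_deriv ?_
    simp [velZ, hv']
  have hz0 : ⟪v, z 0⟫ = 0 := by
    obtain ⟨x, hx⟩ := h0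
    rw [← hx, hv']
  have h1 := le_of_hasDerivWithinAt_Ici_nonpos le_rfl ht hd (fun _ _ => le_rfl)
  have h2 := le_of_hasDerivWithinAt_Ici_nonpos le_rfl ht
    (fun s hs => (hd s hs).neg) (fun _ _ => by simp)
  simp only [Pi.neg_apply] at h2
  linarith

omit [CompleteSpace E] in
theorem exists_bound_g (u : E) (hu : u ∈ S.X) (R : ℝ) :
    ∃ G, 0 ≤ G ∧ ∀ x ∈ S.X, ‖x‖ ≤ R → ‖S.g x‖ ≤ G := by
  obtain ⟨K, hK⟩ := hS.lipschitz_g (max R ‖u‖)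
  refine ⟨K * (max R 0 + ‖u‖) + ‖S.g u‖, by positivity, fun x hx hxR => ?_⟩
  have h1 := hK.dist_le_mul x ⟨hx, by simpa using Or.inl hxR⟩ u ⟨hu, by simp⟩
  rw [dist_eq_norm, dist_eq_norm] at h1
  have h2 : ‖S.g x‖ ≤ ‖S.g x - S.g u‖ + ‖S.g u‖ := by
    simpa using norm_add_le (S.g x - S.g u) (S.g u)
  have h3 : ‖x - u‖ ≤ max R 0 + ‖u‖ :=
    (norm_sub_le _ _).trans (add_le_add_left (hxR.trans (le_max_left _ _)) _)
  have := mul_le_mul_of_nonneg_left h3 K.coe_nonneg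
  linarith

/-- All flows from a given initial state, at whatever speed, stay in a common bounded set. -/
theorem exists_bound_of_isFlow [FiniteDimensional ℝ F] {u : E} {μ : F} (hsad : S.IsSaddle u μ)
    (w₀ : E) (l₀ z₀ : F) (hz₀ : z₀ ∈ range S.L) :
    ∃ R, ∀ (χ : ℝ → ℝ) (w : ℝ → E) (l z : ℝ → F), (∀ t, 0 ≤ χ t) → S.IsFlow χ w l z →
      w 0 = w₀ → l 0 = l₀ → z 0 = z₀ → ∀ t, 0 ≤ t → ‖w t‖ ≤ R ∧ ‖l t‖ ≤ R ∧ ‖z t‖ ≤ R := by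
  obtain ⟨M, hM⟩ := exists_rightInverse_on_range S.L
  have hα := hS.α_pos
  set C := S.lyap M u μ w₀ l₀ z₀ with hC
  have hC0 : 0 ≤ C := hS.lyap_nonneg hM hsad _ _ hz₀
  -- R₁, R₂ and R₃ bound the output, z and l through the initial Lyapunov value C; H bounds the
  -- perturbation h in w' = χ (-α w + h).
  set R₁ := ‖u‖ + √(2 * C)
  set Q := √((‖S.L‖ + 1) * (2 * S.β * C))
  set R₂ := ‖S.A u - S.b‖ + Q
  set R₃ := ‖μ‖ + (√(2 * S.α * C) + Q) / S.α
  obtain ⟨G, hG0, hG⟩ := hS.exists_bound_g u hsad.mem R₁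
  set H := S.α * (R₁ + G + ‖S.At‖ * R₃) + ‖S.At‖ * (‖S.A‖ * R₁ + ‖S.b‖ + R₂) with hH
  have hR₃ : 0 ≤ R₃ := by positivity
  have hH0 : 0 ≤ H := by positivity
  set R₀ := max ‖w₀‖ (H / S.α)
  refine ⟨max R₀ (max R₃ R₂), fun χ w l z hχ hfl hw0 hl0 hzi t ht => ?_⟩
  have hz (s : ℝ) (hs : 0 ≤ s) : z s ∈ range S.L :=
    mem_range_of_isFlow hfl (by rwa [hzi]) hs
  have hV (s : ℝ) (hs : 0 ≤ s) : S.lyap M u μ (w s) (l s) (z s) ≤ C := by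
    have := hS.antitoneOn_lyap hM hsad hχ hfl hz le_rfl hs
    rwa [hw0, hl0, hzi] at this
  have hx (s : ℝ) (hs : 0 ≤ s) : ‖proj S.X (w s)‖ ≤ R₁ := by
    have h1 := hS.norm_sq_proj_sub_le_lyap hM hsad (w s) (l s) (hz s hs)
    have h2 : ‖proj S.X (w s) - u‖ ≤ √(2 * C) := Real.le_sqrt_of_sq_le (by linarith [hV s hs])
    have := norm_add_le (proj S.X (w s) - u) u
    rw [sub_add_cancel] at this
    linarith
  have hζ (s : ℝ) (hs : 0 ≤ s) : ‖z s - (S.A u - S.b)‖ ≤ Q := by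
    have h1 := hS.norm_sq_aux_le_lyap hM hsad (w s) (l s) (hz s hs)
    refine Real.le_sqrt_of_sq_le (h1.trans ?_)
    have := hS.β_pos
    gcongr
    exact hV s hs
  have hzb (s : ℝ) (hs : 0 ≤ s) : ‖z s‖ ≤ R₂ := by
    have := norm_add_le (z s - (S.A u - S.b)) (S.A u - S.b)
    rw [sub_add_cancel] at this
    linarith [hζ s hs]
  have hlb (s : ℝ) (hs : 0 ≤ s) : ‖l s‖ ≤ R₃ := by
    have h1 := hS.norm_sq_mixed_le_lyap hM hsad (w s) (l s) (hz s hs)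
    have h2 : ‖S.α • (l s - μ) + (z s - (S.A u - S.b))‖ ≤ √(2 * S.α * C) := by
      refine Real.le_sqrt_of_sq_le (h1.trans ?_)
      gcongr
      exact hV s hs
    have h3 : ‖S.α • (l s - μ)‖ ≤ √(2 * S.α * C) + Q := by
      have := norm_sub_le (S.α • (l s - μ) + (z s - (S.A u - S.b))) (z s - (S.A u - S.b))
      rw [add_sub_cancel_right] at this
      linarith [hζ s hs]
    rw [norm_smul, Real.norm_of_nonneg hα.le] at h3
    have h4 : ‖l s - μ‖ ≤ (√(2 * S.α * C) + Q) / S.α := by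
      rw [le_div_iff₀ hα]
      linarith
    have := norm_add_le (l s - μ) μ
    rw [sub_add_cancel] at this
    linarith
  have hwb : ‖w t‖ ^ 2 ≤ R₀ ^ 2 := by
    refine le_of_hasDerivWithinAt_Ici_nonpos_above (fun s hs => (hfl.deriv_w s hs).norm_sq)
      ?_ ?_ ht
    · rw [hw0]
      gcongr
      exact le_max_left _ _
    · intro s hs hle
      have hR₀ : 0 ≤ R₀ := (norm_nonneg _).trans (le_max_left _ _)
      have h1 : H / S.α ≤ ‖w s‖ := (le_max_right _ _).trans (le_of_sq_le_sq hle (norm_nonneg _))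
      have h2 : H ≤ S.α * ‖w s‖ := by rwa [div_le_iff₀' hα] at h1
      set x := proj S.X (w s) with hxdef
      set h := S.α • (x - S.g x - S.At (l s)) - S.At (S.res (w s) (z s)) with hh
      have e : S.velW (w s) (l s) (z s) = -S.α • w s + h := by
        rw [velW, hh]; module
      have hg := hG x (proj_mem hS.nonempty hS.closed hS.convex _) (hx s hs)
      have hr : ‖S.res (w s) (z s)‖ ≤ ‖S.A‖ * R₁ + ‖S.b‖ + R₂ := by
        unfold res
        refine (norm_sub_le _ _).trans (add_le_add ((norm_sub_le _ _).trans ?_) (hzb s hs))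
        exact add_le_add_left (S.A.le_opNorm_of_le (hx s hs)) _
      have hhb : ‖h‖ ≤ H := by
        rw [hh, hH]
        refine (norm_sub_le _ _).trans (add_le_add ?_ (S.At.le_opNorm_of_le hr))
        rw [norm_smul, Real.norm_of_nonneg hα.le]
        gcongr
        refine (norm_sub_le _ _).trans (add_le_add ((norm_sub_le _ _).trans ?_)
          (S.At.le_opNorm_of_le (hlb s hs)))
        exact add_le_add (hx s hs) hg
      rw [e, inner_smul_right, inner_add_right, inner_smul_right, real_inner_self_eq_norm_sq]
      have h3 := real_inner_le_norm (w s) h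
      have h4 : ‖w s‖ * ‖h‖ ≤ ‖w s‖ * (S.α * ‖w s‖) := by
        gcongr
        exact hhb.trans h2
      have h5 : χ s * (-S.α * ‖w s‖ ^ 2 + ⟪w s, h⟫) ≤ 0 :=
        mul_nonpos_of_nonneg_of_nonpos (hχ s) (by nlinarith)
      linarith
  have hR₀ : 0 ≤ R₀ := (norm_nonneg _).trans (le_max_left _ _)
  exact ⟨(le_of_sq_le_sq hwb hR₀).trans (le_max_left _ _),
    (hlb t ht).trans ((le_max_left _ _).trans (le_max_right _ _)),
    (hzb t ht).trans ((le_max_right _ _).trans (le_max_right _ _))⟩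

end Regular

end SaddleSystem

namespace SaddleSystem

variable {E F : Type*} [NormedAddCommGroup E] [InnerProductSpace ℝ E]
  [NormedAddCommGroup F] [InnerProductSpace ℝ F] {S : SaddleSystem E F}

namespace Regular

variable [CompleteSpace E] (hS : S.Regular)
include hS

theorem norm_proj_le {w : E} {R : ℝ} (hw : ‖w‖ ≤ R) : ‖proj S.X w‖ ≤ R + ‖proj S.X 0‖ := by
  have h1 := norm_proj_sub_proj_le hS.nonempty hS.closed hS.convex w 0
  rw [sub_zero] at h1
  have h2 := norm_add_le (proj S.X w - proj S.X 0) (proj S.X 0)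
  rw [sub_add_cancel] at h2
  linarith

/-! ### Existence of the flow for all times -/

section Existence

variable [FiniteDimensional ℝ E] [FiniteDimensional ℝ F]

/-- All nonsmoothness passes through the projection and the gradient at it. With these adjoined to
the state by the Lipschitz map T, the velocity is a C¹ function Φ, which is Lipschitz on the compact
image of the ball. -/
theorem exists_lipschitzOnWith_vel (R : ℝ) : ∃ K, LipschitzOnWith K
    (fun s : E × F × F => (S.velW s.1 s.2.1 s.2.2, S.velL s.1 s.2.1 s.2.2, S.velZ s.2.1))
    (closedBall 0 R) := by
  have : ProperSpace E := FiniteDimensional.proper ℝ E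
  have : ProperSpace F := FiniteDimensional.proper ℝ F
  let Φ : (E × F × F) × E × E → E × F × F := fun q =>
    (-S.α • (q.1.1 - q.2.1 + q.2.2 + S.At q.1.2.1) - S.At (S.A q.2.1 - S.b - q.1.2.2),
      S.A q.2.1 - S.b - q.1.2.2 - S.β • S.L q.1.2.1, (S.α * S.β) • S.L q.1.2.1)
  have hΦ : ContDiff ℝ 1 Φ := by fun_prop
  let T : E × F × F → (E × F × F) × E × E := fun s => (s, proj S.X s.1, S.g (proj S.X s.1))
  have hproj : LipschitzOnWith 1 (fun s : E × F × F => proj S.X s.1) (closedBall 0 R) := by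
    have := (lipschitzWith_proj hS.nonempty hS.closed hS.convex).comp
      (LipschitzWith.prod_fst (α := E) (β := F × F))
    rw [mul_one] at this
    exact this.lipschitzOnWith
  have hmaps : MapsTo (fun s : E × F × F => proj S.X s.1) (closedBall 0 R)
      (S.X ∩ closedBall 0 (R + ‖proj S.X 0‖)) := fun s hs => by
    refine ⟨proj_mem hS.nonempty hS.closed hS.convex _, ?_⟩
    rw [mem_closedBall_zero_iff] at hs ⊢
    exact hS.norm_proj_le ((norm_fst_le s).trans hs)
  obtain ⟨K, hK⟩ := hS.lipschitz_g (R + ‖proj S.X 0‖)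
  have hT := (LipschitzWith.id.lipschitzOnWith (s := closedBall (0 : E × F × F) R)).prodMk
    (hproj.prodMk (hK.comp hproj hmaps))
  have hcomp : IsCompact (T '' closedBall 0 R) :=
    (isCompact_closedBall 0 R).image_of_continuousOn hT.continuousOn
  obtain ⟨K', hK'⟩ := (hΦ.locallyLipschitz.locallyLipschitzOn
    (s := T '' closedBall 0 R)).exists_lipschitzOnWith_of_compact hcomp
  exact ⟨_, hK'.comp hT (mapsTo_image T _)⟩

/-- If the problem has a saddle point, then the flow exists for all times. -/
theorem exists_isFlow {u : E} {μ : F} (hsad : S.IsSaddle u μ)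
    (w₀ : E) (l₀ z₀ : F) (hz₀ : z₀ ∈ range S.L) :
    ∃ w l z, S.IsFlow (fun _ => 1) w l z ∧ w 0 = w₀ ∧ l 0 = l₀ ∧ z 0 = z₀ := by
  have : ProperSpace E := FiniteDimensional.proper ℝ E
  have : ProperSpace F := FiniteDimensional.proper ℝ F
  have : CompleteSpace F := FiniteDimensional.complete ℝ F
  obtain ⟨R, hR⟩ := hS.exists_bound_of_isFlow hsad w₀ l₀ z₀ hz₀
  obtain ⟨K, hK⟩ := hS.exists_lipschitzOnWith_vel (R + 1)
  obtain ⟨B, hB⟩ := (isCompact_closedBall (0 : E × F × F) (R + 1)).exists_bound_of_continuousOn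
    hK.continuousOn
  obtain ⟨γ, χ, h0, hχ, hχ1, hγ⟩ :=
    exists_global_solution_of_slowed (x₀ := (w₀, l₀, z₀)) hK hB
  let p₁ := ContinuousLinearMap.fst ℝ E (F × F)
  let p₂ := (ContinuousLinearMap.fst ℝ F F).comp (ContinuousLinearMap.snd ℝ E (F × F))
  let p₃ := (ContinuousLinearMap.snd ℝ F F).comp (ContinuousLinearMap.snd ℝ E (F × F))
  have hfl : S.IsFlow χ (fun t => (γ t).1) (fun t => (γ t).2.1) (fun t => (γ t).2.2) :=
    ⟨fun t ht => p₁.hasFDerivAt.comp_hasDerivWithinAt t (hγ t ht),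
      fun t ht => p₂.hasFDerivAt.comp_hasDerivWithinAt t (hγ t ht),
      fun t ht => p₃.hasFDerivAt.comp_hasDerivWithinAt t (hγ t ht)⟩
  -- The a priori bound does not depend on the speed, so it holds for the slowed flow itself, which
  -- therefore stays where the cutoff is 1.
  have hone (t : ℝ) (ht : 0 ≤ t) : χ t = 1 := by
    obtain ⟨h1, h2, h3⟩ := hR χ _ _ _ hχ hfl (by rw [h0]) (by rw [h0]) (by rw [h0]) t ht
    exact hχ1 t (max_le h1 (max_le h2 h3))
  refine ⟨fun t => (γ t).1, fun t => (γ t).2.1, fun t => (γ t).2.2, ⟨fun t ht => ?_,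
    fun t ht => ?_, fun t ht => ?_⟩, congrArg Prod.fst h0, congrArg (fun s => s.2.1) h0,
    congrArg (fun s => s.2.2) h0⟩
  · simpa only [hone t ht] using hfl.deriv_w t ht
  · simpa only [hone t ht] using hfl.deriv_l t ht
  · simpa only [hone t ht] using hfl.deriv_z t ht

end Existence

/-! ### Decay of the dual gap -/

section Convergence

variable {M : F →L[ℝ] F} (hM : ∀ z ∈ range S.L, S.L (M z) = z)
  {u : E} {μ : F} (hsad : S.IsSaddle u μ)
include hM hsad

/-- Along bounded states, `projDist` relative to any point `v` of `X` decreases at the rate of the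
dual gap at `v`, up to a term controlled by the residuals. -/
theorem inner_velW_le_dualGap {v : E} (hv : v ∈ S.X) {R : ℝ} {w : E} {l z : F} (hw : ‖w‖ ≤ R)
    (hl : ‖l‖ ≤ R) (hzR : ‖z‖ ≤ R) (hz : z ∈ range S.L) :
    ⟪proj S.X w - v, S.velW w l z⟫ ≤
      -S.α * (S.f u - S.f v - ⟪S.A v - S.b, l⟫)
        + (S.α * ‖μ‖ + S.α * R + ‖S.A‖ * (R + ‖proj S.X 0‖ + ‖v‖)) * ‖S.res w z‖
        + S.α * (‖M‖ * R) * ‖S.L l‖ := by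
  have hα := hS.α_pos
  have h1 := hS.inner_velW_le hv w l z
  have hx := hS.norm_proj_le hw
  have h2 := hsad.le _ (proj_mem hS.nonempty hS.closed hS.convex w)
  set x := proj S.X w
  set r := S.res w z with hr
  have e1 : S.A x - S.b = r + z := by rw [hr, res]; abel
  have e2 : S.A (x - v) = r + z - (S.A v - S.b) := by rw [← e1, map_sub]; abel
  have e3 : ⟪S.A (x - v), l⟫ = ⟪r, l⟫ + ⟪z, l⟫ - ⟪S.A v - S.b, l⟫ := by
    rw [e2, inner_sub_left, inner_add_left]
  rw [e1, inner_add_right, hS.inner_eq_zero_of_ker hsad.ker hz, add_zero] at h2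
  rw [e3] at h1
  have b1 : ⟪μ, r⟫ ≤ ‖μ‖ * ‖r‖ := real_inner_le_norm _ _
  have b2 : -⟪r, l⟫ ≤ R * ‖r‖ := by
    have := neg_le_of_abs_le (abs_real_inner_le_norm r l)
    have := mul_le_mul_of_nonneg_left hl (norm_nonneg r)
    linarith
  -- As z lies in range L, ⟪z, l⟫ = ⟪L l, M z⟫, which is small when the consensus error is small.
  have b3 : -⟪z, l⟫ ≤ ‖M‖ * R * ‖S.L l‖ := by
    rw [← hS.inner_rightInverse hM z hz]
    have h3 := neg_le_of_abs_le (abs_real_inner_le_norm (S.L l) (M z))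
    have := mul_le_mul_of_nonneg_left (M.le_opNorm_of_le hzR) (norm_nonneg (S.L l))
    linarith
  have b4 : -⟪S.A (x - v), r⟫ ≤ ‖S.A‖ * (R + ‖proj S.X 0‖ + ‖v‖) * ‖r‖ := by
    have h3 := neg_le_of_abs_le (abs_real_inner_le_norm (S.A (x - v)) r)
    have h4 : ‖x - v‖ ≤ R + ‖proj S.X 0‖ + ‖v‖ :=
      (norm_sub_le _ _).trans (add_le_add_left hx _)
    have := mul_le_mul_of_nonneg_right (S.A.le_opNorm_of_le h4) (norm_nonneg r)
    linarith
  have c1 := mul_le_mul_of_nonneg_left b1 hα.le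
  have c2 := mul_le_mul_of_nonneg_left b2 hα.le
  have c3 := mul_le_mul_of_nonneg_left b3 hα.le
  have c4 := mul_le_mul_of_nonneg_left h2 hα.le
  linarith

/-- Along a bounded flow the dual gap at every point `v` of `X` is eventually almost nonpositive. -/
theorem eventually_dualGap_le {w : ℝ → E} {l z : ℝ → F} (hfl : S.IsFlow (fun _ => 1) w l z)
    (hz : ∀ t, 0 ≤ t → z t ∈ range S.L) {R : ℝ}
    (hR : ∀ t, 0 ≤ t → ‖w t‖ ≤ R ∧ ‖l t‖ ≤ R ∧ ‖z t‖ ≤ R) {v : E} (hv : v ∈ S.X) {δ : ℝ}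
    (hδ : 0 < δ) : ∀ᶠ t in atTop, S.f u - S.f v - ⟪S.A v - S.b, l t⟫ ≤ δ := by
  have hα := hS.α_pos
  have hβ := hS.β_pos
  have hR0 : 0 ≤ R := (norm_nonneg _).trans (hR 0 le_rfl).1
  set c := S.A v - S.b with hc
  set V : ℝ → ℝ := fun t => S.lyap M u μ (w t) (l t) (z t) with hV
  set D : ℝ → ℝ := fun t => projDist S.X v (w t) with hD
  set θ : ℝ → ℝ := fun t => S.f u - S.f v - ⟪c, l t⟫ with hθ
  set CD := (R + ‖v‖) ^ 2 with hCD
  have hDle (t : ℝ) (ht : 0 ≤ t) : D t ≤ CD := by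
    have h1 : ‖w t - v‖ ≤ R + ‖v‖ := (norm_sub_le _ _).trans (add_le_add_left (hR t ht).1 _)
    have h2 := pow_le_pow_left₀ (norm_nonneg _) h1 2
    simp only [hD, projDist]
    nlinarith [sq_nonneg ‖w t - proj S.X (w t)‖, sq_nonneg ‖w t - v‖]
  have hD0 (t : ℝ) : 0 ≤ D t := projDist_nonneg hS.nonempty hS.closed hS.convex hv _
  -- The window length T and the loss rate ε satisfy ε T = CD + 1 and α T δ = 2 (CD + 1), so the
  -- final bound is exactly δ. The weight κ lets the dissipation of the Lyapunov function absorb the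
  -- terms linear in the residuals by Young's inequality.
  set T := 2 * (CD + 1) / (S.α * δ) with hT
  have hT0 : 0 < T := by positivity
  set ε := S.α * δ / 2 with hε
  have hε0 : 0 < ε := by positivity
  set C₁ := S.α * ‖μ‖ + S.α * R + ‖S.A‖ * (R + ‖proj S.X 0‖ + ‖v‖) + S.α * T * ‖c‖ with hC₁
  set C₂ := S.α * (‖M‖ * R) + S.α * T * (‖c‖ * S.β) with hC₂
  have hC₁0 : 0 ≤ C₁ := by positivity
  have hC₂0 : 0 ≤ C₂ := by positivity
  set κ := C₁ ^ 2 / ε + C₂ ^ 2 / (ε * S.β ^ 2) + 1 with hκ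
  have hκ0 : 0 < κ := by positivity
  -- the Lyapunov function eventually varies by less than `1 / κ`
  obtain ⟨a₀, ha₀, hVa⟩ : ∃ a₀, 0 ≤ a₀ ∧ ∀ a b, a₀ ≤ a → a ≤ b → κ * (V a - V b) ≤ 1 := by
    have hbdd : BddBelow (V '' Ici 0) :=
      ⟨0, by rintro _ ⟨t, ht, rfl⟩; exact hS.lyap_nonneg hM hsad _ _ (hz t ht)⟩
    have hne : (V '' Ici 0).Nonempty := ⟨_, 0, mem_Ici.2 le_rfl, rfl⟩
    obtain ⟨_, ⟨a₀, ha₀, rfl⟩, hlt⟩ := exists_lt_of_csInf_lt hne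
      (show sInf (V '' Ici 0) < sInf (V '' Ici 0) + 1 / κ by linarith [one_div_pos.2 hκ0])
    refine ⟨a₀, ha₀, fun a b ha hab => ?_⟩
    have ha0 : 0 ≤ a := le_trans ha₀ ha
    have h1 : V a ≤ V a₀ :=
      hS.antitoneOn_lyap hM hsad (fun _ => zero_le_one) hfl hz ha₀ ha
    have h2 : sInf (V '' Ici 0) ≤ V b := csInf_le hbdd ⟨b, ha0.trans hab, rfl⟩
    have h3 : V a - V b ≤ 1 / κ := by linarith
    have := mul_le_mul_of_nonneg_left h3 hκ0.le
    rwa [mul_one_div_cancel hκ0.ne'] at this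
  have hsmall (C B x : ℝ) (hC : 0 ≤ C) (hB : 0 < B) : C * x ≤ ε / 2 + C ^ 2 / (ε * B ^ 2) *
      (1 / 2 * (B ^ 2 * x ^ 2)) := by
    have h : C ^ 2 / (ε * B ^ 2) * (1 / 2 * (B ^ 2 * x ^ 2)) = C ^ 2 * x ^ 2 / (2 * ε) := by
      field_simp
    rw [h, ← sub_nonneg]
    have : ε / 2 + C ^ 2 * x ^ 2 / (2 * ε) - C * x = (ε - C * x) ^ 2 / (2 * ε) := by
      field_simp; ring
    rw [this]
    positivity
  filter_upwards [eventually_ge_atTop (a₀ + T)] with b hb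
  set a := b - T with ha
  have haa : a₀ ≤ a := by linarith
  have ha0 : 0 ≤ a := ha₀.trans haa
  have hab : a ≤ b := by linarith
  have hθd (t : ℝ) (ht : 0 ≤ t) :
      HasDerivWithinAt θ (-⟪c, S.velL (w t) (l t) (z t)⟫) (Ici 0) t := by
    have := ((innerSL ℝ c).hasFDerivAt.comp_hasDerivWithinAt t (hfl.deriv_l t ht)).const_sub
      (S.f u - S.f v)
    simp only [one_smul, innerSL_apply_apply] at this
    exact this
  -- The weight t - a vanishes at a and equals T at b. Differentiating α (t - a) θ yields α θ, which
  -- cancels the rate -α θ of D, so the pointwise value θ b can be read off at the end of the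
  -- window.
  have hΦ := le_of_hasDerivWithinAt_Ici_nonpos
    (φ := fun t => D t + S.α * ((t - a) * θ t) + κ * V t - ε * t) ha0 hab
    (fun t ht => (((hS.hasDerivWithinAt_projDist hfl v ht).add
      ((((hasDerivAt_id t).sub_const a).hasDerivWithinAt.mul (hθd t ht)).const_mul S.α)).add
      ((hS.hasDerivWithinAt_lyap hfl M u μ ht).const_mul κ)).sub
      (((hasDerivAt_id t).const_mul ε).hasDerivWithinAt)) ?_
  · simp only [sub_self, zero_mul, mul_zero, add_zero] at hΦ
    have h1 := hVa a b haa hab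
    have h2 := hDle a ha0
    have h3 := hD0 b
    have h4 : S.α * (T * θ b) ≤ CD + 1 + ε * T := by
      have : b - a = T := by rw [ha]; ring
      rw [this] at hΦ
      have : ε * b = ε * a + ε * T := by rw [ha]; ring
      linarith
    have h5 : CD + 1 + ε * T = S.α * (T * δ) := by
      rw [hε, hT]; field_simp; ring
    rw [h5] at h4
    exact le_of_mul_le_mul_left (le_of_mul_le_mul_left h4 hα) hT0
  · intro t ht
    have ht0 : 0 ≤ t := ha0.trans ht.1
    obtain ⟨hwR, hlR, hzR⟩ := hR t ht0
    have h1 := hS.inner_velW_le_dualGap hM hsad hv hwR hlR hzR (hz t ht0)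
    have h2 := hS.lyapDeriv_le hM hsad (w t) (l t) (z t) (hz t ht0)
    have h3 := mul_nonneg hα.le (hS.gap_nonneg hsad (w t))
    have h4 : -⟪c, S.velL (w t) (l t) (z t)⟫ ≤
        ‖c‖ * ‖S.res (w t) (z t)‖ + ‖c‖ * S.β * ‖S.L (l t)‖ := by
      refine ((neg_le_abs _).trans (abs_real_inner_le_norm _ _)).trans ?_
      rw [mul_assoc, ← mul_add]
      gcongr
      refine (norm_sub_le _ _).trans ?_
      rw [norm_smul, Real.norm_of_nonneg hβ.le]
    have hta : 0 ≤ t - a := by linarith [ht.1]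
    have htT : t - a ≤ T := by linarith [ht.2]
    set ρ := ‖S.res (w t) (z t)‖
    set y := ‖S.L (l t)‖
    have hρ : 0 ≤ ρ := norm_nonneg _
    have hy : 0 ≤ y := norm_nonneg _
    have h5 : (t - a) * -⟪c, S.velL (w t) (l t) (z t)⟫ ≤ T * (‖c‖ * ρ + ‖c‖ * S.β * y) :=
      (mul_le_mul_of_nonneg_left h4 hta).trans (mul_le_mul_of_nonneg_right htT (by positivity))
    have h6 := mul_le_mul_of_nonneg_left h5 hα.le
    have h7 := hsmall C₁ 1 ρ hC₁0 one_pos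
    have h8 := hsmall C₂ S.β y hC₂0 hβ
    have h9 : κ * S.lyapDeriv M u μ (w t) (l t) (z t) ≤
        -(κ * (1 / 2 * ρ ^ 2 + S.β ^ 2 / 2 * y ^ 2)) := by
      rw [← mul_neg]
      exact mul_le_mul_of_nonneg_left (by linarith) hκ0.le
    have h10 : C₁ ^ 2 / ε * (1 / 2 * ρ ^ 2) + C₂ ^ 2 / (ε * S.β ^ 2) * (S.β ^ 2 / 2 * y ^ 2) ≤
        κ * (1 / 2 * ρ ^ 2 + S.β ^ 2 / 2 * y ^ 2) := by
      rw [mul_add]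
      have p1 : 0 ≤ C₁ ^ 2 / ε := by positivity
      have p2 : 0 ≤ C₂ ^ 2 / (ε * S.β ^ 2) := by positivity
      refine add_le_add (mul_le_mul_of_nonneg_right ?_ (by positivity))
        (mul_le_mul_of_nonneg_right ?_ (by positivity))
      · rw [hκ]; linarith
      · rw [hκ]; linarith
    rw [one_pow, mul_one, one_mul] at h7
    have h11 : C₂ ^ 2 / (ε * S.β ^ 2) * (1 / 2 * (S.β ^ 2 * y ^ 2)) =
      C₂ ^ 2 / (ε * S.β ^ 2) * (S.β ^ 2 / 2 * y ^ 2) := by ring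
    rw [h11] at h8
    have h12 : C₁ * ρ = (S.α * ‖μ‖ + S.α * R + ‖S.A‖ * (R + ‖proj S.X 0‖ + ‖v‖)) * ρ
      + S.α * T * ‖c‖ * ρ := by rw [hC₁]; ring
    have h13 : C₂ * y = S.α * (‖M‖ * R) * y + S.α * T * (‖c‖ * S.β) * y := by rw [hC₂]; ring
    simp only [id_eq, one_mul, mul_one]
    simp only [hθ]
    linarith

end Convergence

end Regular

end SaddleSystem

/-! ### Convergence of the primal output to a saddle point -/

namespace SaddleSystem

variable {E F : Type*} [NormedAddCommGroup E] [InnerProductSpace ℝ E]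
  [NormedAddCommGroup F] [InnerProductSpace ℝ F] {S : SaddleSystem E F}

namespace Regular

variable [CompleteSpace E] (hS : S.Regular)
include hS

theorem continuous_proj : Continuous (proj S.X) :=
  (lipschitzWith_proj hS.nonempty hS.closed hS.convex).continuous

theorem continuous_f_proj : Continuous fun w => S.f (proj S.X w) :=
  hS.continuousOn_f.comp_continuous hS.continuous_proj
    (proj_mem hS.nonempty hS.closed hS.convex)

/-- If the problem has a saddle point, then the primal output of every flow converges to the primal
part of a saddle point. -/
theorem exists_tendsto_proj [FiniteDimensional ℝ E] [FiniteDimensional ℝ F] {u : E} {μ : F}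
    (hsad : S.IsSaddle u μ) {w : ℝ → E} {l z : ℝ → F} (hfl : S.IsFlow (fun _ => 1) w l z)
    (hz₀ : z 0 ∈ range S.L) :
    ∃ v ν, S.IsSaddle v ν ∧ Tendsto (fun t => proj S.X (w t)) atTop (𝓝 v) := by
  have : ProperSpace E := FiniteDimensional.proper ℝ E
  have : ProperSpace F := FiniteDimensional.proper ℝ F
  have hα := hS.α_pos
  have hβ := hS.β_pos
  have hproj := hS.continuous_proj
  have hfproj := hS.continuous_f_proj
  obtain ⟨M, hM⟩ := exists_rightInverse_on_range S.L
  obtain ⟨R, hR⟩ := hS.exists_bound_of_isFlow hsad (w 0) (l 0) (z 0) hz₀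
  replace hR := hR _ w l z (fun _ => zero_le_one) hfl rfl rfl rfl
  have hz (t : ℝ) (ht : 0 ≤ t) : z t ∈ range S.L := mem_range_of_isFlow hfl hz₀ ht
  -- times at which the dissipation is small, and a limit point of the states at these times
  set q : E × F × F → ℝ := fun s =>
    S.α * (S.f (proj S.X s.1) - S.f u + ⟪μ, S.A (proj S.X s.1) - S.b⟫)
      + 1 / 2 * ‖S.res s.1 s.2.2‖ ^ 2 + S.β ^ 2 / 2 * ‖S.L s.2.1‖ ^ 2 with hq
  have hqc : Continuous q := by
    have h1 : Continuous fun s : E × F × F => S.f (proj S.X s.1) := hfproj.comp continuous_fst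
    simp only [hq, res]
    fun_prop
  have hfind (k : ℕ) : ∃ t, (k : ℝ) ≤ t ∧ q (w t, l t, z t) < 1 / (k + 1 : ℝ) := by
    refine exists_ge_lt_of_hasDerivWithinAt_le (m := 0)
      (fun t ht => hS.hasDerivWithinAt_lyap hfl M u μ ht)
      (fun t ht => hS.lyap_nonneg hM hsad _ _ (hz t ht)) (fun t ht => ?_)
      (by positivity) k
    rw [one_mul]
    exact hS.lyapDeriv_le hM hsad (w t) (l t) (z t) (hz t ht)
  choose τ hτ hqτ using hfind
  have hτ0 (k : ℕ) : 0 ≤ τ k := k.cast_nonneg.trans (hτ k)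
  set σ : ℕ → E × F × F := fun k => (w (τ k), l (τ k), z (τ k)) with hσ
  have hσR (k : ℕ) : σ k ∈ closedBall (0 : E × F × F) R := by
    obtain ⟨h1, h2, h3⟩ := hR (τ k) (hτ0 k)
    rw [mem_closedBall_zero_iff]
    exact max_le h1 (max_le h2 h3)
  obtain ⟨⟨w', l', z'⟩, -, ψ, hψ, hlim⟩ := tendsto_subseq_of_bounded isBounded_closedBall hσR
  have hτψ : Tendsto (fun k => τ (ψ k)) atTop atTop :=
    tendsto_atTop_mono (fun k => (Nat.cast_le.2 (hψ.id_le k)).trans (hτ (ψ k)))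
      tendsto_natCast_atTop_atTop
  have hliml : Tendsto (fun k => l (τ (ψ k))) atTop (𝓝 l') :=
    ((continuous_fst.comp continuous_snd).tendsto _).comp hlim
  have hlimz : Tendsto (fun k => z (τ (ψ k))) atTop (𝓝 z') :=
    ((continuous_snd.comp continuous_snd).tendsto _).comp hlim
  -- the limit point is stationary
  have hq0 : q (w', l', z') ≤ 0 := by
    refine le_of_tendsto_of_tendsto ((hqc.tendsto _).comp hlim)
      (tendsto_one_div_add_atTop_nhds_zero_nat.comp hψ.tendsto_atTop)
      (Eventually.of_forall fun k => (hqτ (ψ k)).le)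
  have hgap := hS.gap_nonneg hsad w'
  have hgap' := mul_nonneg hα.le hgap
  have hr0 : S.res w' z' = 0 := by
    have h1 : 0 ≤ S.β ^ 2 / 2 * ‖S.L l'‖ ^ 2 := by positivity
    have h2 : ‖S.res w' z'‖ ^ 2 ≤ 0 := by
      simp only [hq] at hq0
      linarith
    exact norm_eq_zero.1 (pow_eq_zero_iff two_ne_zero |>.1 (le_antisymm h2 (sq_nonneg _)))
  have hy0 : S.L l' = 0 := by
    have h1 : S.β ^ 2 / 2 * ‖S.L l'‖ ^ 2 ≤ 0 := by
      have : 0 ≤ ‖S.res w' z'‖ ^ 2 := sq_nonneg _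
      simp only [hq] at hq0
      linarith
    have h2 : ‖S.L l'‖ ^ 2 ≤ 0 := nonpos_of_mul_nonpos_right h1 (by positivity)
    exact norm_eq_zero.1 (pow_eq_zero_iff two_ne_zero |>.1 (le_antisymm h2 (sq_nonneg _)))
  have hz' : z' ∈ range S.L := by
    have hcl : IsClosed (range S.L) := (S.L : F →ₗ[ℝ] F).range.closed_of_finiteDimensional
    exact hcl.mem_of_tendsto hlimz (Eventually.of_forall fun k => hz _ (hτ0 _))
  set x' := proj S.X w' with hx'
  have hAx : S.A x' - S.b = z' := by
    rw [res, sub_eq_zero] at hr0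
    exact hr0
  have hfx : S.f x' = S.f u := by
    have h1 : ⟪μ, S.A x' - S.b⟫ = 0 := by
      rw [hAx]
      exact hS.inner_eq_zero_of_ker hsad.ker hz'
    have h2 : S.α * (S.f x' - S.f u + ⟪μ, S.A x' - S.b⟫) ≤ 0 := by
      have : 0 ≤ ‖S.res w' z'‖ ^ 2 := sq_nonneg _
      have : 0 ≤ S.β ^ 2 / 2 * ‖S.L l'‖ ^ 2 := by positivity
      simp only [hq] at hq0
      linarith
    have h3 := nonpos_of_mul_nonpos_right h2 hα
    linarith
  -- Stationarity of the dissipation does not give this inequality; it is the limit of the eventual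
  -- dual gap bounds along the subsequence.
  have hdual (v : E) (hv : v ∈ S.X) : S.f u ≤ S.f v + ⟪l', S.A v - S.b⟫ := by
    refine le_of_forall_pos_le_add fun δ hδ => ?_
    have h1 := hτψ.eventually (hS.eventually_dualGap_le hM hsad hfl hz hR hv hδ)
    have h2 : Tendsto (fun k => S.f u - S.f v - ⟪S.A v - S.b, l (τ (ψ k))⟫) atTop
        (𝓝 (S.f u - S.f v - ⟪S.A v - S.b, l'⟫)) :=
      tendsto_const_nhds.sub (tendsto_const_nhds.inner hliml)
    have h3 := le_of_tendsto h2 h1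
    rw [real_inner_comm] at h3
    linarith
  have hsad' : S.IsSaddle x' l' :=
    { mem := proj_mem hS.nonempty hS.closed hS.convex _
      feasible := by rwa [hAx]
      ker := hy0
      le := fun v hv => by
        rw [hfx]
        exact hdual v hv }
  refine ⟨x', l', hsad', ?_⟩
  -- the Lyapunov function relative to the limit point vanishes there
  have hVc : Continuous fun s : E × F × F => S.lyap M x' l' s.1 s.2.1 s.2.2 := by
    have h1 : Continuous fun s : E × F × F => projDist S.X x' s.1 :=
      (continuous_projDist hS.nonempty hS.closed hS.convex x').comp continuous_fst
    simp only [lyap]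
    fun_prop
  have hV0 : S.lyap M x' l' w' l' z' = 0 := by
    rw [lyap, hAx, hx', projDist_proj_self, hy0]
    simp
  have hVlim := (hVc.tendsto (w', l', z')).comp hlim
  simp only [hV0] at hVlim
  rw [Metric.tendsto_atTop]
  intro ε hε
  -- A single time with Lyapunov value below ε² / 2 suffices: the value never increases afterwards
  -- and ‖x - x'‖² is at most twice it.
  obtain ⟨k, hk⟩ := (hVlim.eventually (gt_mem_nhds (show 0 < ε ^ 2 / 2 by positivity))).exists
  refine ⟨τ (ψ k), fun t ht => ?_⟩
  have h1 := hS.antitoneOn_lyap hM hsad' (fun _ => zero_le_one) hfl hz (hτ0 (ψ k)) ht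
  have h2 := hS.norm_sq_proj_sub_le_lyap hM hsad' (w t) (l t) (hz t ((hτ0 (ψ k)).trans ht))
  have h3 : S.lyap M x' l' (w (τ (ψ k))) (l (τ (ψ k))) (z (τ (ψ k))) < ε ^ 2 / 2 := hk
  rw [dist_eq_norm]
  exact lt_of_pow_lt_pow_left₀ 2 hε.le (by linarith)

end Regular

end SaddleSystem

/-! ### Derivatives and maps of stacked vectors -/

theorem hasDerivWithinAt_piLp {ι : Type*} [Fintype ι] {V : ι → Type*}
    [∀ i, NormedAddCommGroup (V i)] [∀ i, NormedSpace ℝ (V i)] {γ : ℝ → PiLp 2 V} {γ' : PiLp 2 V}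
    {s : Set ℝ} {t : ℝ} :
    HasDerivWithinAt γ γ' s t ↔ ∀ i, HasDerivWithinAt (fun r => γ r i) (γ' i) s t := by
  simp only [hasDerivWithinAt_iff_hasFDerivWithinAt]
  rw [hasFDerivWithinAt_piLp]
  refine forall_congr' fun i => ?_
  have : (PiLp.proj 2 V i).comp (ContinuousLinearMap.toSpanSingleton ℝ γ') =
      ContinuousLinearMap.toSpanSingleton ℝ (γ' i) := by
    ext
    simp
  rw [← this]

/-- The continuous linear map into an `ℓ²` product with given components. -/
def piLpMap {ι G : Type*} [Fintype ι] {V : ι → Type*} [NormedAddCommGroup G] [NormedSpace ℝ G]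
    [∀ i, NormedAddCommGroup (V i)] [∀ i, NormedSpace ℝ (V i)] (T : ∀ i, G →L[ℝ] V i) :
    G →L[ℝ] PiLp 2 V :=
  ((PiLp.continuousLinearEquiv 2 ℝ V).symm : (∀ i, V i) →L[ℝ] PiLp 2 V).comp
    (ContinuousLinearMap.pi T)

theorem piLpMap_apply {ι G : Type*} [Fintype ι] {V : ι → Type*} [NormedAddCommGroup G]
    [NormedSpace ℝ G] [∀ i, NormedAddCommGroup (V i)] [∀ i, NormedSpace ℝ (V i)]
    (T : ∀ i, G →L[ℝ] V i) (x : G) (i : ι) : piLpMap T x i = T i x := rfl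

/-! ### The graph Laplacian -/

section Laplacian

variable {n p : ℕ} (a : Matrix (Fin n) (Fin n) ℝ)

/-- The Laplacian of a weighted graph acting on stacked vectors. -/
def graphLaplacian (p : ℕ) : Stack n p →L[ℝ] Stack n p :=
  let π (i : Fin n) : Stack n p →L[ℝ] Vec p := PiLp.proj 2 (fun _ => Vec p) i
  piLpMap fun i => ∑ j, a i j • (π i - π j)

theorem graphLaplacian_apply (y : Stack n p) (i : Fin n) :
    graphLaplacian a p y i = ∑ j, a i j • (y i - y j) := by
  simp [graphLaplacian, piLpMap_apply, sum_apply]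

variable {a}

/-- Summation by parts: exchanging i and j, with symmetric weights, flips the sign of the edge
difference. Symmetry, positivity and the kernel of the Laplacian are read off from this form. -/
theorem inner_graphLaplacian (ha : a.IsSymm) (x y : Stack n p) :
    ⟪graphLaplacian a p x, y⟫ = 1 / 2 * ∑ i, ∑ j, a i j * ⟪x i - x j, y i - y j⟫ := by
  have h1 : ⟪graphLaplacian a p x, y⟫ = ∑ i, ∑ j, a i j * ⟪x i - x j, y i⟫ := by
    rw [PiLp.inner_apply]
    simp only [graphLaplacian_apply, sum_inner, inner_smul_left, RCLike.conj_to_real]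
  have h2 : ∑ i, ∑ j, a i j * ⟪x i - x j, y j⟫ = -∑ i, ∑ j, a i j * ⟪x i - x j, y i⟫ := by
    rw [Finset.sum_comm, ← Finset.sum_neg_distrib]
    refine Finset.sum_congr rfl fun i _ => ?_
    rw [← Finset.sum_neg_distrib]
    refine Finset.sum_congr rfl fun j _ => ?_
    rw [ha.apply i j, ← neg_sub (x i) (x j), inner_neg_left, mul_neg]
  simp only [inner_sub_right, mul_sub, Finset.sum_sub_distrib] at h1 h2 ⊢
  rw [h1, h2]
  ring

theorem inner_graphLaplacian_symm (ha : a.IsSymm) (x y : Stack n p) :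
    ⟪graphLaplacian a p x, y⟫ = ⟪x, graphLaplacian a p y⟫ := by
  rw [real_inner_comm (graphLaplacian a p y) x, inner_graphLaplacian ha, inner_graphLaplacian ha]
  simp only [real_inner_comm]

theorem inner_graphLaplacian_nonneg (ha : a.IsSymm) (h0 : ∀ i j, 0 ≤ a i j) (x : Stack n p) :
    0 ≤ ⟪x, graphLaplacian a p x⟫ := by
  rw [← inner_graphLaplacian_symm ha, inner_graphLaplacian ha]
  refine mul_nonneg (by norm_num) (Finset.sum_nonneg fun i _ => Finset.sum_nonneg fun j _ => ?_)
  exact mul_nonneg (h0 i j) real_inner_self_nonneg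

/-- The edge energy is a sum of nonnegative terms equal to zero, so x agrees across every edge, and
then along every path. -/
theorem eq_of_graphLaplacian_eq_zero (ha : a.IsSymm) (h0 : ∀ i j, 0 ≤ a i j)
    (hc : GraphConnected a) {x : Stack n p} (hx : graphLaplacian a p x = 0) (i j : Fin n) :
    x i = x j := by
  have h1 := inner_graphLaplacian ha x x
  rw [hx, inner_zero_left] at h1
  have hnn (k l : Fin n) : 0 ≤ a k l * ⟪x k - x l, x k - x l⟫ :=
    mul_nonneg (h0 k l) real_inner_self_nonneg
  have h2 : ∑ k, ∑ l, a k l * ⟪x k - x l, x k - x l⟫ = 0 := by linarith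
  have h3 (k l : Fin n) : a k l * ⟪x k - x l, x k - x l⟫ = 0 := by
    have h4 := (Finset.sum_eq_zero_iff_of_nonneg fun k _ =>
      Finset.sum_nonneg fun l _ => hnn k l).1 h2 k (Finset.mem_univ _)
    exact (Finset.sum_eq_zero_iff_of_nonneg fun l _ => hnn k l).1 h4 l (Finset.mem_univ _)
  induction hc i j with
  | refl => rfl
  | tail _ hkl ih =>
    rw [ih]
    have := (mul_eq_zero.1 (h3 _ _)).resolve_left hkl.ne'
    exact sub_eq_zero.1 (inner_self_eq_zero.1 this)

theorem graphLaplacian_toLp_const (v : Vec p) :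
    graphLaplacian a p (WithLp.toLp 2 fun _ => v) = 0 := by
  ext i : 1
  simp [graphLaplacian_apply]

/-- For a connected graph the range of the Laplacian consists of the stacked vectors that sum up to
zero. -/
theorem mem_range_graphLaplacian_iff (ha : a.IsSymm) (h0 : ∀ i j, 0 ≤ a i j)
    (hc : GraphConnected a) (z : Stack n p) :
    z ∈ range (graphLaplacian a p) ↔ ∑ i, z i = 0 := by
  constructor
  · rintro ⟨y, rfl⟩
    refine ext_inner_left ℝ fun v => ?_
    have h1 := inner_graphLaplacian_symm ha (WithLp.toLp 2 fun _ => v) y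
    rw [graphLaplacian_toLp_const, inner_zero_left, PiLp.inner_apply] at h1
    rw [inner_sum, inner_zero_right]
    exact h1.symm
  · intro hz
    set W : Submodule ℝ (Stack n p) := (graphLaplacian a p : Stack n p →ₗ[ℝ] Stack n p).range
    change z ∈ W
    -- A vector orthogonal to the range lies in the kernel by symmetry, so it is consensual, and it
    -- pairs to zero with a zero-sum stack.
    rw [← W.orthogonal_orthogonal]
    intro v hv
    have hv0 : graphLaplacian a p v = 0 := by
      refine ext_inner_right ℝ fun y => ?_
      rw [inner_graphLaplacian_symm ha, inner_zero_left, real_inner_comm]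
      exact hv _ (LinearMap.mem_range_self (graphLaplacian a p : Stack n p →ₗ[ℝ] Stack n p) y)
    have hcons := eq_of_graphLaplacian_eq_zero ha h0 hc hv0
    rw [PiLp.inner_apply]
    rcases isEmpty_or_nonempty (Fin n) with hn | ⟨⟨k⟩⟩
    · simp
    · rw [Finset.sum_congr rfl fun i _ => by rw [hcons i k], ← inner_sum, hz, inner_zero_right]

end Laplacian

/-! ### The coupled problem as a saddle system -/

namespace CoupledProblem

variable {n p : ℕ} {d : Fin n → ℕ} (P : CoupledProblem n p d)

/-- The block-diagonal operator `(x_i) ↦ (A_i x_i)`. -/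
def blockA : Primal d →L[ℝ] Stack n p :=
  piLpMap fun i => (P.A i).toEuclideanLin.toContinuousLinearMap.comp (PiLp.proj 2 _ i)

/-- The block-diagonal operator `(y_i) ↦ (A_iᵀ y_i)`. -/
def blockAt : Stack n p →L[ℝ] Primal d :=
  piLpMap fun i => (P.A i).transpose.toEuclideanLin.toContinuousLinearMap.comp (PiLp.proj 2 _ i)

theorem blockA_apply (x : Primal d) (i : Fin n) :
    P.blockA x i = (P.A i).toEuclideanLin (x i) := rfl

theorem blockAt_apply (y : Stack n p) (i : Fin n) :
    P.blockAt y i = (P.A i).transpose.toEuclideanLin (y i) := rfl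

theorem inner_blockA (x : Primal d) (y : Stack n p) :
    ⟪P.blockA x, y⟫ = ⟪x, P.blockAt y⟫ := by
  rw [PiLp.inner_apply, PiLp.inner_apply]
  refine Finset.sum_congr rfl fun i _ => ?_
  rw [blockA_apply, blockAt_apply, ← Matrix.conjTranspose_eq_transpose_of_trivial,
    Matrix.toEuclideanLin_conjTranspose_eq_adjoint, LinearMap.adjoint_inner_right]

/-- The stacked gradient `(∇ f_i (x_i))`. -/
def gradCost (x : Primal d) : Primal d := WithLp.toLp 2 fun i => ∇ (P.f i) (x i)

/-- The saddle system whose flow is Proj-IDEA. -/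
def saddleSystem (a : Matrix (Fin n) (Fin n) ℝ) (bs : Fin n → Vec p) (α β : ℝ) :
    SaddleSystem (Primal d) (Stack n p) where
  X := P.prodSet
  f := P.cost
  g := P.gradCost
  A := P.blockA
  At := P.blockAt
  L := graphLaplacian a p
  b := WithLp.toLp 2 bs
  α := α
  β := β

theorem isTrajectory_iff (a : Matrix (Fin n) (Fin n) ℝ) (bs : Fin n → Vec p) (α β : ℝ)
    (w : ℝ → Primal d) (lam z : ℝ → Stack n p) :
    P.IsTrajectory a bs α β w lam z ↔
      (P.saddleSystem a bs α β).IsFlow (fun _ => 1) w lam z := by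
  have hw (w : Primal d) (l z : Stack n p) (i : Fin n) :
      (P.saddleSystem a bs α β).velW w l z i =
        -α • (w i - proj P.prodSet w i + ∇ (P.f i) (proj P.prodSet w i)
          + (P.A i).transpose.toEuclideanLin (l i))
        - (P.A i).transpose.toEuclideanLin
          ((P.A i).toEuclideanLin (proj P.prodSet w i) - bs i - z i) := rfl
  have hl (w : Primal d) (l z : Stack n p) (i : Fin n) :
      (P.saddleSystem a bs α β).velL w l z i =
        (P.A i).toEuclideanLin (proj P.prodSet w i) - bs i - z i
          - β • ∑ j, a i j • (l i - l j) := by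
    rw [← graphLaplacian_apply]
    rfl
  have hz (l : Stack n p) (i : Fin n) :
      (P.saddleSystem a bs α β).velZ l i = (α * β) • ∑ j, a i j • (l i - l j) := by
    rw [← graphLaplacian_apply]
    rfl
  constructor
  · rintro ⟨h1, h2, h3⟩
    refine ⟨fun t ht => ?_, fun t ht => ?_, fun t ht => ?_⟩ <;>
      rw [one_smul, hasDerivWithinAt_piLp] <;> intro i
    · rw [hw]
      exact h1 t ht i
    · rw [hl]
      exact h2 t ht i
    · rw [hz]
      exact h3 t ht i
  · rintro ⟨h1, h2, h3⟩
    refine ⟨fun t ht i => ?_, fun t ht i => ?_, fun t ht i => ?_⟩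
    · have := h1 t ht
      rw [one_smul, hasDerivWithinAt_piLp] at this
      rw [← hw]
      exact this i
    · have := h2 t ht
      rw [one_smul, hasDerivWithinAt_piLp] at this
      rw [← hl]
      exact this i
    · have := h3 t ht
      rw [one_smul, hasDerivWithinAt_piLp] at this
      rw [← hz]
      exact this i

theorem sum_blockA_sub (bs : Fin n → Vec p) (hbs : ∑ i, bs i = P.b) (x : Primal d) :
    ∑ i, (P.blockA x - WithLp.toLp 2 bs) i = ∑ i, (P.A i).toEuclideanLin (x i) - P.b := by
  simp [blockA_apply, hbs]

section Assumptions

variable {P}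

theorem isClosed_prodSet (hX : ∀ i, IsClosed (P.X i)) : IsClosed P.prodSet := by
  have : P.prodSet = ⋂ i, (fun x : Primal d => x i) ⁻¹' P.X i := by
    ext x
    simp [prodSet]
  rw [this]
  exact isClosed_iInter fun i => (hX i).preimage (PiLp.continuous_apply 2 _ i)

theorem convex_prodSet (hX : ∀ i, Convex ℝ (P.X i)) : Convex ℝ P.prodSet :=
  fun _ hx _ hy _ _ hs ht hst i => hX i (hx i) (hy i) hs ht hst

theorem convexOn_cost (hX : ∀ i, Convex ℝ (P.X i)) (hf : ∀ i, ConvexOn ℝ (P.X i) (P.f i)) :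
    ConvexOn ℝ P.prodSet P.cost := by
  refine ⟨convex_prodSet hX, fun x hx y hy s t hs ht hst => ?_⟩
  simp only [cost, smul_eq_mul, Finset.mul_sum, ← Finset.sum_add_distrib]
  exact Finset.sum_le_sum fun i _ => (hf i).2 (hx i) (hy i) hs ht hst

theorem exists_lipschitzOnWith_gradCost (hX : ∀ i, IsClosed (P.X i))
    (hf : ∀ i, LocallyLipschitzOn (P.X i) (∇ (P.f i))) (R : ℝ) :
    ∃ K, LipschitzOnWith K P.gradCost (P.prodSet ∩ closedBall 0 R) := by
  have h (i : Fin n) : ∃ K, LipschitzOnWith K (∇ (P.f i)) (P.X i ∩ closedBall 0 R) :=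
    ((hf i).mono inter_subset_left).exists_lipschitzOnWith_of_compact
      ((isCompact_closedBall 0 R).inter_left (hX i))
  choose K hK using h
  -- The sum of the local constants serves as a common upper bound for them.
  refine ⟨∑ i, K i, LipschitzOnWith.of_dist_le_mul fun x hx y hy => ?_⟩
  have hmem (x : Primal d) (hx : x ∈ P.prodSet ∩ closedBall 0 R) (i : Fin n) :
      x i ∈ P.X i ∩ closedBall 0 R := by
    refine ⟨hx.1 i, ?_⟩
    have := hx.2
    rw [mem_closedBall_zero_iff] at this ⊢
    exact (PiLp.norm_apply_le x i).trans this
  rw [dist_eq_norm, dist_eq_norm]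
  refine le_of_sq_le_sq ?_ (by positivity)
  rw [mul_pow, PiLp.norm_sq_eq_of_L2, PiLp.norm_sq_eq_of_L2, Finset.mul_sum]
  refine Finset.sum_le_sum fun i _ => ?_
  rw [← mul_pow]
  refine pow_le_pow_left₀ (norm_nonneg _) ?_ 2
  have h1 := (hK i).dist_le_mul _ (hmem x hx i) _ (hmem y hy i)
  rw [dist_eq_norm, dist_eq_norm] at h1
  refine h1.trans (mul_le_mul_of_nonneg_right ?_ (norm_nonneg _))
  exact_mod_cast Finset.single_le_sum (f := K) (fun _ _ => zero_le) (Finset.mem_univ i)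

theorem cost_add_inner_le (hd : ∀ i, ∀ x ∈ P.X i, DifferentiableAt ℝ (P.f i) x)
    (hf : ∀ i, ConvexOn ℝ (P.X i) (P.f i)) {x u : Primal d} (hx : x ∈ P.prodSet)
    (hu : u ∈ P.prodSet) : P.cost x + ⟪P.gradCost x, u - x⟫ ≤ P.cost u := by
  rw [PiLp.inner_apply, cost, cost, ← Finset.sum_add_distrib]
  exact Finset.sum_le_sum fun i _ => (hf i).add_inner_gradient_le (hx i) (hu i) (hd i _ (hx i))

theorem continuousOn_cost (hd : ∀ i, ∀ x ∈ P.X i, DifferentiableAt ℝ (P.f i) x) :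
    ContinuousOn P.cost P.prodSet := by
  refine continuousOn_finsetSum _ fun i _ => ?_
  exact ContinuousOn.comp (t := P.X i)
    (fun x hx => (hd i x hx).continuousAt.continuousWithinAt)
    (PiLp.continuous_apply 2 _ i).continuousOn fun x hx => hx i

variable {a : Matrix (Fin n) (Fin n) ℝ} (h0 : ∀ i j, 0 ≤ a i j) (ha : a.IsSymm)
  (hc : GraphConnected a) {bs : Fin n → Vec p} (hbs : ∑ i, bs i = P.b)
include h0 ha hc hbs

/-- Membership in the range only sees the sum over the agents, so the particular splitting of b
drops out. -/
theorem feasible_iff_coupled (x : Primal d) :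
    P.blockA x - WithLp.toLp 2 bs ∈ range (graphLaplacian a p) ↔ P.Coupled x := by
  rw [mem_range_graphLaplacian_iff ha h0 hc, P.sum_blockA_sub bs hbs, sub_eq_zero]
  rfl

/-- The primal part of a saddle point is an optimal solution. -/
theorem isOptimal_of_isSaddle {α β : ℝ} {u : Primal d} {μ : Stack n p}
    (h : (P.saddleSystem a bs α β).IsSaddle u μ) : P.IsOptimal u := by
  refine ⟨⟨h.mem, (feasible_iff_coupled h0 ha hc hbs u).1 h.feasible⟩, fun y hy hyc => ?_⟩
  have h1 := h.le y hy
  obtain ⟨v, hv⟩ := (feasible_iff_coupled h0 ha hc hbs y).2 hyc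
  have h2 : ⟪μ, P.blockA y - WithLp.toLp 2 bs⟫ = 0 := by
    rw [← hv, ← inner_graphLaplacian_symm ha]
    have : graphLaplacian a p μ = 0 := h.ker
    rw [this, inner_zero_left]
  change P.cost u ≤ P.cost y + ⟪μ, P.blockA y - WithLp.toLp 2 bs⟫ at h1
  linarith

/-- Under Slater's condition an optimal solution is the primal part of a saddle point. -/
theorem exists_isSaddle_of_isOptimal (hf : ConvexOn ℝ P.prodSet P.cost) (hsl : P.Slater)
    {u : Primal d} (hu : P.IsOptimal u) (α β : ℝ) :
    ∃ μ, (P.saddleSystem a bs α β).IsSaddle u μ := by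
  let B : Primal d →ₗ[ℝ] Vec p := ∑ i, (P.A i).toEuclideanLin ∘ₗ (PiLp.projₗ 2 (fun i => Vec (d i)) i)
  have hB (x : Primal d) : B x = ∑ i, (P.A i).toEuclideanLin (x i) := by
    simp [B]
  obtain ⟨m, hm⟩ := exists_lagrange_multiplier hf B (c := P.b) (m := P.cost u)
    (fun y hy hyc => hu.2 y hy (by rwa [hB] at hyc))
    (by
      obtain ⟨x, hx, hxc⟩ := hsl
      exact ⟨x, hx, by rwa [hB]⟩)
  set v : Vec p := (InnerProductSpace.toDual ℝ (Vec p)).symm (LinearMap.toContinuousLinearMap m)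
  have hv (y : Vec p) : ⟪v, y⟫ = m y := by
    simp [v, InnerProductSpace.toDual_symm_apply]
  -- Every agent receives the same multiplier v; the resulting stack lies in the kernel of the
  -- Laplacian, and pairing with it sums the local residuals.
  refine ⟨WithLp.toLp 2 fun _ => v, hu.1.1, (feasible_iff_coupled h0 ha hc hbs u).2 hu.1.2,
    graphLaplacian_toLp_const v, fun x hx => ?_⟩
  have h1 := hm x hx
  rw [hB, ← P.sum_blockA_sub bs hbs, ← hv, inner_sum] at h1
  change P.cost u ≤ P.cost x + ⟪_, P.blockA x - WithLp.toLp 2 bs⟫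
  rw [PiLp.inner_apply]
  exact h1

end Assumptions

end CoupledProblem

namespace CoupledProblem

variable {n p : ℕ} {d : Fin n → ℕ} {P : CoupledProblem n p d}

theorem regular_saddleSystem {a : Matrix (Fin n) (Fin n) ℝ} (h0 : ∀ i j, 0 ≤ a i j)
    (ha : a.IsSymm) (hX_closed : ∀ i, IsClosed (P.X i)) (hX_convex : ∀ i, Convex ℝ (P.X i))
    (hf : ∀ i, ConvexOn ℝ (P.X i) (P.f i))
    (hd : ∀ i, ∀ x ∈ P.X i, DifferentiableAt ℝ (P.f i) x)
    (hlip : ∀ i, LocallyLipschitzOn (P.X i) (∇ (P.f i))) (hne : P.prodSet.Nonempty)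
    (bs : Fin n → Vec p) {α β : ℝ} (hα : 0 < α) (hβ : 0 < β) :
    (P.saddleSystem a bs α β).Regular where
  nonempty := hne
  closed := isClosed_prodSet hX_closed
  convex := convex_prodSet hX_convex
  add_inner_le := fun _ hx _ hu => cost_add_inner_le hd hf hx hu
  continuousOn_f := continuousOn_cost hd
  lipschitz_g := exists_lipschitzOnWith_gradCost hX_closed hlip
  adjoint := P.inner_blockA
  symm := inner_graphLaplacian_symm ha
  pos := inner_graphLaplacian_nonneg ha h0
  α_pos := hα
  β_pos := hβ

end CoupledProblem

end ProjIDEA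

end

theorem theorem5 {n p : ℕ} {d : Fin n → ℕ} (P : ProjIDEA.CoupledProblem n p d)
    -- the weighted undirected connected graph
    (a : Matrix (Fin n) (Fin n) ℝ) (ha_nonneg : ∀ i j, 0 ≤ a i j) (ha_symm : a.IsSymm)
    (ha_conn : ProjIDEA.GraphConnected a)
    -- the assumptions on the problem
    (hX_closed : ∀ i, IsClosed (P.X i))
    (hX_convex : ∀ i, Convex ℝ (P.X i))
    (hf_convex : ∀ i, ConvexOn ℝ (P.X i) (P.f i))
    (hf_smooth : ∀ i, ∃ U : Set (ProjIDEA.Vec (d i)), IsOpen U ∧ P.X i ⊆ U ∧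
      DifferentiableOn ℝ (P.f i) U ∧ LocallyLipschitzOn U (∇ (P.f i)))
    (h_slater : P.Slater)
    (h_opt : ∃ x, P.IsOptimal x)
    -- the splitting of `b` among the agents and the step sizes
    (bs : Fin n → ProjIDEA.Vec p) (hbs : ∑ i, bs i = P.b)
    (α β : ℝ) (hα : 0 < α) (hβ : 0 < β)
    -- the initial state
    (w₀ : ProjIDEA.Primal d) (lam₀ z₀ : ProjIDEA.Stack n p) (hz₀ : ∑ i, z₀ i = 0) :
    (∃ (w : ℝ → ProjIDEA.Primal d) (lam z : ℝ → ProjIDEA.Stack n p),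
      P.IsTrajectory a bs α β w lam z ∧ w 0 = w₀ ∧ lam 0 = lam₀ ∧ z 0 = z₀) ∧
    ∀ (w : ℝ → ProjIDEA.Primal d) (lam z : ℝ → ProjIDEA.Stack n p),
      P.IsTrajectory a bs α β w lam z → w 0 = w₀ → lam 0 = lam₀ → z 0 = z₀ →
      ∃ xstar, P.IsOptimal xstar ∧
        Filter.Tendsto (fun t => ProjIDEA.proj P.prodSet (w t)) Filter.atTop (𝓝 xstar) := by
  obtain ⟨u, hu⟩ := h_opt
  have hd : ∀ i, ∀ x ∈ P.X i, DifferentiableAt ℝ (P.f i) x := fun i x hx => by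
    obtain ⟨U, hU, hXU, hdiff, -⟩ := hf_smooth i
    exact hdiff.differentiableAt (hU.mem_nhds (hXU hx))
  have hlip : ∀ i, LocallyLipschitzOn (P.X i) (∇ (P.f i)) := fun i => by
    obtain ⟨U, -, hXU, -, hl⟩ := hf_smooth i
    exact hl.mono hXU
  have hS := ProjIDEA.CoupledProblem.regular_saddleSystem ha_nonneg ha_symm hX_closed hX_convex
    hf_convex hd hlip ⟨u, hu.1.1⟩ bs hα hβ
  obtain ⟨μ, hsad⟩ := ProjIDEA.CoupledProblem.exists_isSaddle_of_isOptimal ha_nonneg ha_symm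
    ha_conn hbs (ProjIDEA.CoupledProblem.convexOn_cost hX_convex hf_convex) h_slater hu α β
  have hz := (ProjIDEA.mem_range_graphLaplacian_iff ha_symm ha_nonneg ha_conn z₀).2 hz₀
  constructor
  · obtain ⟨w, l, z, hfl, hw, hl, hzi⟩ := hS.exists_isFlow hsad w₀ lam₀ z₀ hz
    exact ⟨w, l, z, (P.isTrajectory_iff a bs α β w l z).2 hfl, hw, hl, hzi⟩
  · intro w lam z htraj _ _ hzi
    obtain ⟨v, ν, hv, hlim⟩ := hS.exists_tendsto_proj hsad
      ((P.isTrajectory_iff a bs α β w lam z).1 htraj) (by rw [hzi]; exact hz)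
    exact ⟨v, ProjIDEA.CoupledProblem.isOptimal_of_isSaddle ha_nonneg ha_symm ha_conn hbs hv, hlim⟩
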